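/- **Model.** All quantities except $G$, the exponential family, $a$, $\rho_a$ and the constants named below may vary along a sequence of models, and limits are taken along it. There are $K$ data sources; source $k$ provides a first batch of $n_k$ observations $(\mathbf x^{(k)}_i,y^{(k)}_i)\in\mathbb R^p\times\mathbb R$, with design matrix $\mathbf X^{(k)}$. The sample sizes satisfy $n_k\asymp n_*\to\infty$ uniformly in $k$; $p$, $K$ and the sparsity $s$ below may diverge. The sources are partitioned into a fixed number $G\ge 2$ of nonempty subgroups $\mathcal G^{(1)},\dots,\mathcal G^{(G)}$, and $\boldsymbol\beta^{*(k)}=\boldsymbol\xi^{*(g)}$ for $k\in\mathcal G^{(g)}$. Given the covariates, the responses are independent, and $y_i^{(k)}$ has the density $c(y;\phi^{(k)})\exp[y\theta-d(\theta)]$, $\theta=\mathbf x_i^{(k)\top}\boldsymbol\beta^{*(k)}$, with respect to a fixed $\sigma$-finite measure; here $c(\cdot;\phi^{(k)})\exp[y\theta-d(\theta)]$ is a probability density for every $\theta\in\mathbb R$. The covariates may be random or fixed. Put $\mathcal A_g=\{j:\xi^{*(g)}_j\ne0\}$, $\mathcal B_k=\mathcal A_g$ for $k\in\mathcal G^{(g)}$,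 $s=\max_g|\mathcal A_g|$, $N=\sum_kn_k$, $\bar N_1=\min_g\sum_{k\in\mathcal G^{(g)}}n_k$, $d_1=\min_{k,\,j\in\mathcal B_k}|\beta_j^{*(k)}|$, $d_2=\min\|\boldsymbol\beta^{*(k)}-\boldsymbol\beta^{*(k')}\|_2$ over $k,k'$ in different subgroups, $\boldsymbol\Sigma(\boldsymbol\varphi)=\mathrm{diag}\{d''(\varphi_i)\}$, and let $L^{(k)}(\boldsymbol\beta)=\sum_i[y_i^{(k)}\mathbf x_i^{(k)\top}\boldsymbol\beta-d(\mathbf x_i^{(k)\top}\boldsymbol\beta)]$. The objective for $\mathbf B=(\boldsymbol\beta^{(1)},\dots,\boldsymbol\beta^{(K)})\in\mathbb R^{p\times K}$ is $$\mathcal Q_1^{\rm on}(\mathbf B)=-\frac1N\sum_kL^{(k)}(\boldsymbol\beta^{(k)})+\sum_{k,j}\rho_a(|\beta^{(k)}_j|,\lambda_1)+\sum_{k<k'}\rho_a(\|\boldsymbol\beta^{(k)}-\boldsymbol\beta^{(k')}\|_2,\lambda_2).$$ The oracle estimator $\widehat{\boldsymbol\Xi}{}^{or}_1$ minimizes $-\frac1N\sum_g\sum_{k\in\mathcal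 G^{(g)}}L^{(k)}(\boldsymbol\xi^{(g)})$ subject to $\boldsymbol\xi^{(g)}_{\mathcal A_g^c}=\mathbf 0$ for all $g$; the oracle estimator $\widehat{\mathbf B}{}^{or}_1$ minimizes $-\frac1N\sum_kL^{(k)}(\boldsymbol\beta^{(k)})$ over the $\mathbf B$ with $\boldsymbol\beta^{(k)}=\boldsymbol\beta^{(k')}$ for $k,k'$ in the same subgroup and $\boldsymbol\beta^{(k)}_{\mathcal B_k^c}=\mathbf 0$. (Wherever a minimizer exists, any minimizer may be chosen.) **Conditions.** Let $C_x,c_1,C_1,C_2,C_3,\kappa,a>0$ be constants. (i) $|x_{ij}^{(k)}|\le C_x$ and $\sigma_{\max}[\mathbf X_{\mathcal A_g}^{(k)\top}\mathbf X^{(k)}_{\mathcal A_g}]\le C_xn_k$ for $k\in\mathcal G^{(g)}$. (ii) $d_1>2a\lambda_1$, $d_2>2a\lambda_2$, $\lambda_1\gg\sqrt{[\log(pK)+s]/\bar N_1}$, $\lambda_2\gg\sqrt{s/\bar N_1}$. (iii) For $k\in\mathcal G^{(g)}$ and all $\boldsymbol\alpha\in\mathbb R^{|\mathcal A_g|}$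 with $\|\boldsymbol\alpha-\boldsymbol\xi^{*(g)}_{\mathcal A_g}\|_\infty\le d_1/2$, the eigenvalues of $\mathbf X_{\mathcal A_g}^{(k)\top}\boldsymbol\Sigma(\mathbf X^{(k)}_{\mathcal A_g}\boldsymbol\alpha)\mathbf X^{(k)}_{\mathcal A_g}$ lie in $[c_1n_k,C_1n_k]$, and those of $\mathbf X_{\mathcal A_g}^{(k)\top}\mathrm{diag}_i\{|x^{(k)}_{ij}|\,d'''((\mathbf X^{(k)}_{\mathcal A_g}\boldsymbol\alpha)_i)\}\mathbf X^{(k)}_{\mathcal A_g}$ are at most $C_2n_k$ for every $j\in[p]$. (iv) Given the covariates, for every $g$, $\epsilon>0$ and nonzero vector $\boldsymbol\eta=(\eta_i^{(k)})_{k\in\mathcal G^{(g)},\,i}$, $$\Pr\Big[\Big|\sum_{k\in\mathcal G^{(g)}}\sum_i\eta_i^{(k)}\{y_i^{(k)}-d'(\mathbf x_i^{(k)\top}\boldsymbol\xi^{*(g)})\}\Big|<\|\boldsymbol\eta\|_2\,\epsilon\Big]>1-2e^{-\kappa\epsilon^2}.$$ (v) $\|\mathbf X_{\mathcal A_g^c}^{(k)\top}\boldsymbol\Sigma(\mathbf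 X^{(k)}\boldsymbol\beta^{*(k)})\mathbf X^{(k)}_{\mathcal A_g}\|_{2,\infty}\le C_3n_k$ for $k\in\mathcal G^{(g)}$, where $\|\mathbf H\|_{2,\infty}=\max_{\|\mathbf v\|_2=1}\|\mathbf H\mathbf v\|_\infty$. (vi) For every $\lambda>0$: $\rho_a(\cdot,\lambda)$ is symmetric, $\rho_a(0,\lambda)=0$; on $[0,\infty)$ it is non-decreasing, concave and continuously differentiable with $\rho_a'(0+,\lambda)=\lambda$; it is constant on $|x|\ge a\lambda$. (The minimax concave penalty is an example.) The design conditions (i), (iii), (iv), (v) are only required to hold jointly with probability tending to one over the covariates. **Theorem 1.** Under these conditions, with probability tending to one both oracle estimators exist and are unique, and: (1) $\max_{g}\|\widehat{\boldsymbol\xi}{}^{or(g)}_{1,\mathcal A_g}-\boldsymbol\xi^{*(g)}_{\mathcal A_g}\|_2=O_p(\sqrt{s/\bar N_1})$ and $\max_{k}\|\widehat{\boldsymbol\beta}{}^{or(k)}_{1,\mathcal B_k}-\boldsymbol\beta^{*(k)}_{\mathcal B_k}\|_2=O_p(\sqrt{s/\bar N_1})$. (2) There is a choice $\widehat{\mathbf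 B}_1$, as a function of the outcome, that is a strict local minimizer of $\mathcal Q_1^{\rm on}$ at every outcome at which $\mathcal Q_1^{\rm on}$ has one, such that with probability tending to one $\widehat{\mathbf B}_1$ is a strict local minimizer of $\mathcal Q_1^{\rm on}$ and $\widehat{\mathbf B}_1=\widehat{\mathbf B}{}^{or}_1$. Consequently, with probability tending to one, the support of $\widehat{\boldsymbol\beta}{}^{(k)}_1$ is $\mathcal B_k$ for all $k$, and the partition of the sources according to equality of the columns $\widehat{\boldsymbol\beta}{}^{(k)}_1$ is $\{\mathcal G^{(1)},\dots,\mathcal G^{(G)}\}$. -/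

import Mathlib

open MeasureTheory Filter Topology

namespace FOL

noncomputable section

/-! ### Vectors and matrices -/

/-- The Euclidean norm of a real vector. -/
def l2Norm {ι : Type*} [Fintype ι] (v : ι → ℝ) : ℝ := ‖(WithLp.toLp 2 v : EuclideanSpace ℝ ι)‖

/-- The support `{j : v j ≠ 0}` of a vector. -/
def supp {p : ℕ} (v : Fin p → ℝ) : Finset (Fin p) := Finset.univ.filter fun j => v j ≠ 0

/-- The largest eigenvalue is at most `c` (used for symmetric matrices only). -/
def MaxEigLE {ι : Type*} [Fintype ι] [DecidableEq ι] (H : Matrix ι ι ℝ) (c : ℝ) : Prop :=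
  ∀ σ ∈ spectrum ℝ H, σ ≤ c

/-- The smallest eigenvalue is at least `c` (used for symmetric matrices only). -/
def MinEigGE {ι : Type*} [Fintype ι] [DecidableEq ι] (H : Matrix ι ι ℝ) (c : ℝ) : Prop :=
  ∀ σ ∈ spectrum ℝ H, c ≤ σ

/-- `‖H‖_{2,∞} ≤ c`, where `‖H‖_{2,∞} = max_{‖v‖₂ = 1} ‖H v‖_∞`. -/
def TwoInfLE {ι κ : Type*} [Fintype κ] (H : Matrix ι κ ℝ) (c : ℝ) : Prop :=
  ∀ v : κ → ℝ, l2Norm v = 1 → ∀ j, |H.mulVec v j| ≤ c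

/-- The submatrix of the columns with index in `A`. -/
def cols {n p : ℕ} (X : Matrix (Fin n) (Fin p) ℝ) (A : Finset (Fin p)) :
    Matrix (Fin n) {j // j ∈ A} ℝ := X.submatrix id Subtype.val

/-! ### Asymptotics in probability along a sequence of probability spaces -/

section Probability

variable {Ω : ℕ → Type*} [∀ t, MeasurableSpace (Ω t)]

/-- The events `E t` have probability tending to one. As `P t` is an outer measure on
non-measurable sets, no measurability of `E t` is needed: some measurable event contained in
`E t` has probability tending to one. -/
def WHP (P : ∀ t, Measure (Ω t)) (E : ∀ t, Set (Ω t)) : Prop :=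
  Tendsto (fun t => P t (E t)ᶜ) atTop (𝓝 0)

/-- `Z t = O_p (r t)`. -/
def IsBigOp (P : ∀ t, Measure (Ω t)) (Z : ∀ t, Ω t → ℝ) (r : ℕ → ℝ) : Prop :=
  ∀ ε : ℝ, 0 < ε → ∃ M : ℝ, 0 < M ∧
    ∀ᶠ t in atTop, P t {ω | M * r t < |Z t ω|} ≤ ENNReal.ofReal ε

end Probability

/-! ### The canonical exponential family -/

/-- The density `c(y; φ) exp(y θ - d(θ))` with respect to the dominating measure. -/
def glmDensity (c : ℝ → ℝ → ℝ) (d : ℝ → ℝ) (φ θ y : ℝ) : ℝ := c y φ * Real.exp (y * θ - d θ)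

/-- The law on `ℝ` with density `glmDensity c d φ θ` with respect to `m`. -/
def glmLaw (m : Measure ℝ) (c : ℝ → ℝ → ℝ) (d : ℝ → ℝ) (φ θ : ℝ) : Measure ℝ :=
  m.withDensity fun y => ENNReal.ofReal (glmDensity c d φ θ y)

/-- For the dispersion `φ`, the function `glmDensity c d φ θ` is a probability density for every
value `θ` of the natural parameter. -/
structure IsExpFamily (m : Measure ℝ) (c : ℝ → ℝ → ℝ) (d : ℝ → ℝ) (φ : ℝ) : Prop where
  measurable : Measurable fun y => c y φ
  nonneg : ∀ y, 0 ≤ c y φ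
  isProbability : ∀ θ, IsProbabilityMeasure (glmLaw m c d φ θ)

/-! ### The model, at one stage of the asymptotics -/

/-- The parameters of the model with `G` subgroups: `K` sources with `n k` observations each,
`p` covariates, the subgroup `grp k` of source `k`, the true coefficients `xi g` of subgroup
`g`, and the dispersion parameters `phi k`. -/
structure Model (G : ℕ) where
  K : ℕ
  p : ℕ
  n : Fin K → ℕ
  grp : Fin K → Fin G
  xi : Fin G → Fin p → ℝ
  phi : Fin K → ℝ

namespace Model

variable {G : ℕ} (M : Model G)

/-- The true coefficients of source `k`. -/
def beta (k : Fin M.K) : Fin M.p → ℝ := M.xi (M.grp k)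

/-- The sources in subgroup `g`. -/
def members (g : Fin G) : Finset (Fin M.K) := Finset.univ.filter fun k => M.grp k = g

/-- The significant variables of subgroup `g`. -/
def A (g : Fin G) : Finset (Fin M.p) := supp (M.xi g)

/-- `s = max_g s_g`. -/
def s : ℕ := Finset.univ.sup fun g => (M.A g).card

/-- The total sample size of the first batch. -/
def N : ℕ := ∑ k, M.n k

/-- The minimal sample size of a subgroup in the first batch. -/
def Nbar : ℕ := ⨅ g : Fin G, ∑ k ∈ M.members g, M.n k

/-- The minimal signal level. -/
def d1 : ℝ := sInf {r | ∃ k, ∃ j ∈ M.A (M.grp k), r = |M.beta k j|}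

/-- The minimal distance between different subgroups. -/
def d2 : ℝ := sInf {r | ∃ k k', M.grp k ≠ M.grp k' ∧ r = l2Norm (M.beta k - M.beta k')}

/-- The design matrices of all the sources. -/
abbrev Design : Type := (k : Fin M.K) → Fin (M.n k) → Fin M.p → ℝ

/-- The responses of all the sources. -/
abbrev Resp : Type := (k : Fin M.K) → Fin (M.n k) → ℝ

/-- The coefficients of all the sources. -/
abbrev Coef : Type := Fin M.K → Fin M.p → ℝ

/-- The design matrix of source `k`. -/
def mat (x : M.Design) (k : Fin M.K) : Matrix (Fin (M.n k)) (Fin M.p) ℝ := Matrix.of (x k)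

/-- The conditional law of the responses given that the design is `x`: independent responses,
the `i`-th one of source `k` having natural parameter `x_i^{(k)⊤} β^{*(k)}`. -/
def respLaw (m : Measure ℝ) (c : ℝ → ℝ → ℝ) (d : ℝ → ℝ) (x : M.Design) : Measure M.Resp :=
  Measure.pi fun k => Measure.pi fun i => glmLaw m c d (M.phi k) (x k i ⬝ᵥ M.beta k)

/-- `respLaw` is the conditional distribution of the responses `Y` given the design `X`. -/
def IsData {Ω : Type*} [MeasurableSpace Ω] (m : Measure ℝ) (c : ℝ → ℝ → ℝ) (d : ℝ → ℝ)
    (P : Measure Ω) (X : Ω → M.Design) (Y : Ω → M.Resp) : Prop :=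
  Measurable X ∧ Measurable Y ∧
    ∀ S : Set (M.Design × M.Resp), MeasurableSet S →
      P {ω | (X ω, Y ω) ∈ S} = ∫⁻ ω, M.respLaw m c d (X ω) {y | (X ω, y) ∈ S} ∂P

/-! #### Conditions on a realized design -/

/-- The matrix `Σ(φ) = diag{d''(φ_i)}`. -/
def Sig {n : ℕ} (d : ℝ → ℝ) (φ : Fin n → ℝ) : Matrix (Fin n) (Fin n) ℝ :=
  Matrix.diagonal fun i => iteratedDeriv 2 d (φ i)

/-- The neighbourhood of radius `d₁ / 2` in sup norm of the true nonzero coefficients of `g`. -/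
def nhd (g : Fin G) : Set ({j // j ∈ M.A g} → ℝ) :=
  {α | ∀ j, |α j - M.xi g j| ≤ M.d1 / 2}

/-- The design matrix of source `k`, restricted to the significant variables. -/
def matA (x : M.Design) (k : Fin M.K) :
    Matrix (Fin (M.n k)) {j // j ∈ M.A (M.grp k)} ℝ := cols (M.mat x k) (M.A (M.grp k))

/-- Bounded design. -/
def BoundedDesign (Cx : ℝ) (x : M.Design) : Prop :=
  (∀ k i j, |x k i j| ≤ Cx) ∧
    ∀ k, MaxEigLE ((M.matA x k).transpose * M.matA x k) (Cx * M.n k)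

/-- Eigenvalue bounds near the true coefficients. -/
def EigenBounds (d : ℝ → ℝ) (c1 C1 C2 : ℝ) (x : M.Design) : Prop :=
  ∀ k, ∀ α ∈ M.nhd (M.grp k),
    MinEigGE ((M.matA x k).transpose * Sig d ((M.matA x k).mulVec α) * M.matA x k)
      (c1 * M.n k) ∧
    MaxEigLE ((M.matA x k).transpose * Sig d ((M.matA x k).mulVec α) * M.matA x k)
      (C1 * M.n k) ∧
    ∀ j, MaxEigLE
      ((M.matA x k).transpose *
        Matrix.diagonal (fun i => |x k i j| * iteratedDeriv 3 d ((M.matA x k).mulVec α i)) *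
        M.matA x k)
      (C2 * M.n k)

/-- Given the design `x`, linear combinations of the errors of a subgroup are sub-Gaussian. -/
def SubGaussianErrors (m : Measure ℝ) (c : ℝ → ℝ → ℝ) (d : ℝ → ℝ) (κ : ℝ)
    (x : M.Design) : Prop :=
  ∀ (g : Fin G) (η : M.Resp), 0 < ∑ k ∈ M.members g, ∑ i, η k i ^ 2 → ∀ ε : ℝ, 0 < ε →
    1 - 2 * Real.exp (-κ * ε ^ 2) <
      (M.respLaw m c d x).real
        {y | |∑ k ∈ M.members g, ∑ i, η k i * (y k i - deriv d (x k i ⬝ᵥ M.xi g))| <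
          √(∑ k ∈ M.members g, ∑ i, η k i ^ 2) * ε}

/-- Bound on the interaction of the unimportant with the significant variables. -/
def CrossBound (d : ℝ → ℝ) (C3 : ℝ) (x : M.Design) : Prop :=
  ∀ k, TwoInfLE
    ((cols (M.mat x k) (M.A (M.grp k))ᶜ).transpose *
      Sig d ((M.mat x k).mulVec (M.beta k)) * M.matA x k)
    (C3 * M.n k)

/-- All the conditions on the design. -/
def Regular (m : Measure ℝ) (c : ℝ → ℝ → ℝ) (d : ℝ → ℝ) (Cx c1 C1 C2 κ C3 : ℝ)
    (x : M.Design) : Prop :=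
  M.BoundedDesign Cx x ∧ M.EigenBounds d c1 C1 C2 x ∧ M.SubGaussianErrors m c d κ x ∧
    M.CrossBound d C3 x

/-! #### Likelihood, oracle estimators and penalized objective -/

/-- The log-likelihood of source `k`, up to a term that is free of the coefficients. -/
def logLik (d : ℝ → ℝ) (x : M.Design) (y : M.Resp) (k : Fin M.K) (b : Fin M.p → ℝ) : ℝ :=
  ∑ i, (y k i * (x k i ⬝ᵥ b) - d (x k i ⬝ᵥ b))

/-- The loss as a function of the coefficients of all the sources. -/
def loss (d : ℝ → ℝ) (x : M.Design) (y : M.Resp) (B : M.Coef) : ℝ :=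
  -(1 / (M.N : ℝ)) * ∑ k, M.logLik d x y k (B k)

/-- The loss as a function of the coefficients of the subgroups. -/
def lossXi (d : ℝ → ℝ) (x : M.Design) (y : M.Resp) (Ξ : Fin G → Fin M.p → ℝ) : ℝ :=
  -(1 / (M.N : ℝ)) * ∑ g, ∑ k ∈ M.members g, M.logLik d x y k (Ξ g)

/-- Coefficients of the subgroups that vanish off the significant variables. -/
def spaceXi : Set (Fin G → Fin M.p → ℝ) := {Ξ | ∀ g, ∀ j ∉ M.A g, Ξ g j = 0}

/-- Coefficients of the sources that respect the subgroup structure. -/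
def spaceG : Set M.Coef := {B | ∀ k k', M.grp k = M.grp k' → B k = B k'}

/-- Coefficients of the sources that respect the sparsity structure. -/
def spaceB : Set M.Coef := {B | ∀ k, ∀ j ∉ supp (M.beta k), B k j = 0}

/-- `Ξ` is a subgroup-sparsity-oracle estimate of the subgroup coefficients. -/
def IsOracleXi (d : ℝ → ℝ) (x : M.Design) (y : M.Resp) (Ξ : Fin G → Fin M.p → ℝ) : Prop :=
  Ξ ∈ M.spaceXi ∧ IsMinOn (M.lossXi d x y) M.spaceXi Ξ

/-- `B` is a subgroup-sparsity-oracle estimate of the coefficients of the sources. -/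
def IsOracleB (d : ℝ → ℝ) (x : M.Design) (y : M.Resp) (B : M.Coef) : Prop :=
  B ∈ M.spaceG ∩ M.spaceB ∧ IsMinOn (M.loss d x y) (M.spaceG ∩ M.spaceB) B

/-- The penalized objective function for the first batch. -/
def Q (d : ℝ → ℝ) (ρ : ℝ → ℝ → ℝ) (lam1 lam2 : ℝ) (x : M.Design) (y : M.Resp)
    (B : M.Coef) : ℝ :=
  M.loss d x y B + ∑ k, ∑ j, ρ |B k j| lam1 +
    ∑ k, ∑ k' ∈ Finset.Ioi k, ρ (l2Norm (B k - B k')) lam2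

/-- `max_g ‖ξ^{(g)}_{A_g} - ξ^{*(g)}_{A_g}‖₂`. -/
def errXi (Ξ : Fin G → Fin M.p → ℝ) : ℝ :=
  ⨆ g, l2Norm fun j : {j // j ∈ M.A g} => Ξ g j - M.xi g j

/-- `max_k ‖β^{(k)}_{B_k} - β^{*(k)}_{B_k}‖₂`. -/
def errB (B : M.Coef) : ℝ :=
  ⨆ k, l2Norm fun j : {j // j ∈ supp (M.beta k)} => B k j - M.beta k j

end Model

/-- `x₀` is a strict local minimizer of `f`. -/
def IsStrictLocalMin {E : Type*} [TopologicalSpace E] (f : E → ℝ) (x₀ : E) : Prop :=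
  ∀ᶠ x in 𝓝[≠] x₀, f x₀ < f x

/-- The conditions on the penalty `ρ x lam` with concavity parameter `a`. -/
structure IsPenalty (ρ : ℝ → ℝ → ℝ) (a : ℝ) : Prop where
  even : ∀ lam > 0, ∀ x, ρ (-x) lam = ρ x lam
  zero : ∀ lam > 0, ρ 0 lam = 0
  monotone : ∀ lam > 0, MonotoneOn (fun x => ρ x lam) (Set.Ici 0)
  concave : ∀ lam > 0, ConcaveOn ℝ (Set.Ici 0) fun x => ρ x lam
  differentiable : ∀ lam > 0, DifferentiableOn ℝ (fun x => ρ x lam) (Set.Ici 0)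
  continuous_deriv : ∀ lam > 0,
    ContinuousOn (derivWithin (fun x => ρ x lam) (Set.Ici 0)) (Set.Ici 0)
  deriv_zero : ∀ lam > 0, derivWithin (fun x => ρ x lam) (Set.Ici 0) 0 = lam
  const : ∀ lam > 0, ∃ C, ∀ x, a * lam ≤ |x| → ρ x lam = C

end

end FOL

/-! The oracle estimator solves, in each subgroup, a low-dimensional convex problem. On the sphere
of radius `R ≍ √(s / N̄)` around the truth, the quadratic growth of the negative log-likelihood beats
the score, whose Euclidean norm in the significant directions is `O_p(√(s N_g))` by Markov's
inequality. As `d₁ > 2 a λ₁ ≫ √(s / N̄)`, this sphere lies in the region of strong convexity, so a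
unique minimizer exists, and it lies inside the sphere (`IsTame.exists_oracle`).

The oracle estimator is a strict local minimizer of the penalized objective for two reasons. The
penalties of the significant coefficients and of the differences between subgroups are locally
constant, because their arguments exceed `a λ`. The penalties of the other coefficients and of the
differences within a subgroup grow with slope `λ₁`, resp. `λ₂`, from `0`, and this beats the score
of a single source at the oracle estimator: off the significant directions the score is at most
`N λ₁ / 4` in sup norm; in the significant directions it sums to zero over a subgroup, so only the
differences within the subgroup count, and it is at most `N λ₂ / 8` in Euclidean norm
(`IsGroupwiseMin.isStrictLocalMin_Q`).

The score of a source at the oracle estimator is the score at the truth plus a drift. The drift is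
controlled without the third derivative of `d`, and without a bound on the change of the natural
parameters: a sub-Gaussian response satisfies
`d (θ + t) - d θ - t d' θ = log E exp (t (y - d' θ)) ≤ 4 t² / κ` for every `t`
(`logPartition_sub_le`), and by convexity of `d` this yields
`|d' (θ + u) - d' θ| ≤ 16 |u| / κ` for every `u` (`abs_deriv_sub_le`).

A deterministic lemma (`IsTame.exists_isGood`) derives all the claims on the event of small noise
at a regular design. The probability of that event is bounded conditionally on the design
(`SubGaussianErrors.measure_not_isSmallNoise_le`) and then integrated over it
(`IsData.measure_le`). -/

namespace FOL

/-! ### Euclidean norms and quadratic forms -/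

section Norm

variable {ι : Type*} [Fintype ι]

lemma l2Norm_nonneg (v : ι → ℝ) : 0 ≤ l2Norm v := norm_nonneg _

lemma l2Norm_sq (v : ι → ℝ) : l2Norm v ^ 2 = ∑ j, v j ^ 2 := by
  simp [l2Norm, EuclideanSpace.norm_sq_eq]

lemma l2Norm_eq_sqrt (v : ι → ℝ) : l2Norm v = √(∑ j, v j ^ 2) := by
  rw [← l2Norm_sq, Real.sqrt_sq (l2Norm_nonneg v)]

lemma continuous_l2Norm : Continuous (l2Norm : (ι → ℝ) → ℝ) :=
  (PiLp.continuous_toLp 2 _).norm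

lemma l2Norm_smul (c : ℝ) (v : ι → ℝ) : l2Norm (c • v) = |c| * l2Norm v := by
  simp [l2Norm, norm_smul]

lemma l2Norm_neg (v : ι → ℝ) : l2Norm (-v) = l2Norm v := by
  simp [l2Norm]

lemma l2Norm_sub_comm (v w : ι → ℝ) : l2Norm (v - w) = l2Norm (w - v) := by
  rw [← l2Norm_neg, neg_sub]

lemma l2Norm_add_le (v w : ι → ℝ) : l2Norm (v + w) ≤ l2Norm v + l2Norm w := by
  simpa [l2Norm] using norm_add_le (WithLp.toLp 2 v : EuclideanSpace ℝ ι) (WithLp.toLp 2 w)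

@[simp] lemma l2Norm_zero : l2Norm (0 : ι → ℝ) = 0 := by simp [l2Norm]

lemma l2Norm_eq_zero {v : ι → ℝ} : l2Norm v = 0 ↔ v = 0 := by simp [l2Norm]

lemma abs_apply_le_l2Norm (v : ι → ℝ) (j : ι) : |v j| ≤ l2Norm v := by
  simpa [l2Norm] using PiLp.norm_apply_le (WithLp.toLp 2 v : EuclideanSpace ℝ ι) j

lemma l2Norm_mono {v w : ι → ℝ} (h : ∀ j, |v j| ≤ |w j|) : l2Norm v ≤ l2Norm w := by
  rw [l2Norm_eq_sqrt, l2Norm_eq_sqrt]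
  exact Real.sqrt_le_sqrt (Finset.sum_le_sum fun j _ => sq_le_sq.2 (h j))

/-- Restricting a vector to an index set off which it vanishes keeps its Euclidean norm. -/
lemma l2Norm_restrict (A : Finset ι) {v : ι → ℝ} (hv : ∀ j ∉ A, v j = 0) :
    l2Norm (fun j : {j // j ∈ A} => v j) = l2Norm v := by
  rw [l2Norm_eq_sqrt, l2Norm_eq_sqrt]
  congr 1
  rw [← Finset.sum_subset (Finset.subset_univ A) fun j _ hj => by rw [hv j hj]; norm_num]
  exact Finset.sum_coe_sort A (fun j => v j ^ 2)

end Norm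

/-- Cauchy-Schwarz inequality. -/
lemma abs_sum_mul_le {ι : Type*} (s : Finset ι) (v w : ι → ℝ) :
    |∑ j ∈ s, v j * w j| ≤ √(∑ j ∈ s, v j ^ 2) * √(∑ j ∈ s, w j ^ 2) := by
  rw [← Real.sqrt_mul (Finset.sum_nonneg fun j _ => sq_nonneg _)]
  exact Real.abs_le_sqrt (Finset.sum_mul_sq_le_sq_mul_sq s v w)

section Eigenvalues

open Matrix

lemma MinEigGE.quadForm_le {ι : Type*} [Fintype ι] [DecidableEq ι] {H : Matrix ι ι ℝ}
    {c : ℝ} (hH : H.IsHermitian) (h : MinEigGE H c)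
    (v : ι → ℝ) : c * ∑ j, v j ^ 2 ≤ v ⬝ᵥ (H *ᵥ v) := by
  have hps : (H - algebraMap ℝ _ c).PosSemidef := by
    rw [posSemidef_iff_isHermitian_and_spectrum_nonneg]
    refine ⟨hH.sub ?_, ?_⟩
    · rw [Matrix.algebraMap_eq_diagonal]
      exact Matrix.isHermitian_diagonal _
    · rw [← spectrum.sub_singleton_eq]
      rintro _ ⟨σ, hσ, _, rfl, rfl⟩
      exact sub_nonneg.2 (h σ hσ)
  have h0 := hps.dotProduct_mulVec_nonneg v
  simp only [star_trivial, Matrix.sub_mulVec, dotProduct_sub] at h0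
  have h1 : v ⬝ᵥ (algebraMap ℝ (Matrix ι ι ℝ) c *ᵥ v) = c * ∑ j, v j ^ 2 := by
    rw [Matrix.algebraMap_eq_diagonal, dotProduct, Finset.mul_sum]
    refine Finset.sum_congr rfl fun j _ => ?_
    rw [Matrix.mulVec_diagonal]
    simp
    ring
  linarith

lemma MaxEigLE.quadForm_le {ι : Type*} [Fintype ι] [DecidableEq ι] {H : Matrix ι ι ℝ}
    {c : ℝ} (hH : H.IsHermitian) (h : MaxEigLE H c)
    (v : ι → ℝ) : v ⬝ᵥ (H *ᵥ v) ≤ c * ∑ j, v j ^ 2 := by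
  have h1 : MinEigGE (-H) (-c) := by
    intro σ hσ
    rw [← spectrum.neg_eq] at hσ
    have := h (-σ) hσ
    linarith
  have := h1.quadForm_le hH.neg v
  rw [Matrix.neg_mulVec, dotProduct_neg] at this
  linarith

/-- The quadratic form of a weighted Gram matrix. -/
lemma quadForm_gram {ι : Type*} [Fintype ι] {n : ℕ} (Z : Matrix (Fin n) ι ℝ) (w : Fin n → ℝ)
    (v : ι → ℝ) :
    v ⬝ᵥ ((Zᵀ * Matrix.diagonal w * Z) *ᵥ v) = ∑ i, w i * (Z *ᵥ v) i ^ 2 := by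
  rw [← Matrix.mulVec_mulVec, ← Matrix.mulVec_mulVec, Matrix.dotProduct_mulVec,
    Matrix.vecMul_transpose, dotProduct]
  refine Finset.sum_congr rfl fun i _ => ?_
  rw [Matrix.mulVec_diagonal]
  ring

lemma isHermitian_gram {ι : Type*} {n : ℕ} (Z : Matrix (Fin n) ι ℝ) (w : Fin n → ℝ) :
    (Zᵀ * Matrix.diagonal w * Z).IsHermitian := by
  have := Matrix.isHermitian_conjTranspose_mul_mul Z (Matrix.isHermitian_diagonal w)
  simpa [Matrix.conjTranspose_eq_transpose_of_trivial] using this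

end Eigenvalues

/-! ### One-dimensional convexity -/

/-- The tangent line inequality for a differentiable convex function. -/
lemma tangent_le {f : ℝ → ℝ} (hf : ConvexOn ℝ Set.univ f) (hd : Differentiable ℝ f) (x y : ℝ) :
    f x + deriv f x * (y - x) ≤ f y := by
  rcases lt_trichotomy x y with h | h | h
  · have := hf.deriv_le_slope (Set.mem_univ x) (Set.mem_univ y) h (hd x)
    rw [slope_def_field, le_div_iff₀ (by linarith)] at this
    linarith
  · simp [h]
  · have := hf.slope_le_deriv (Set.mem_univ y) (Set.mem_univ x) h (hd x)
    rw [slope_def_field, div_le_iff₀ (by linarith)] at this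
    linarith

/-- A function with second derivative at least `c` on the unit interval lies above its tangent
at `0` by at least `c / 2` at the point `1`. -/
lemma quadratic_tangent_le {f f' f'' : ℝ → ℝ} {c : ℝ} (h1 : ∀ t, HasDerivAt f (f' t) t)
    (h2 : ∀ t, HasDerivAt f' (f'' t) t) (hc : ∀ t ∈ Set.Ioo (0 : ℝ) 1, c ≤ f'' t) :
    f 0 + f' 0 + c / 2 ≤ f 1 := by
  have mono1 : MonotoneOn (fun t => f' t - c * t) (Set.Icc 0 1) := by
    have hd : ∀ t, HasDerivAt (fun t => f' t - c * t) (f'' t - c) t := fun t => by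
      have := (h2 t).sub ((hasDerivAt_id t).const_mul c)
      exact this.congr_deriv (by simp)
    refine monotoneOn_of_deriv_nonneg (convex_Icc 0 1)
      (fun t _ => (hd t).continuousAt.continuousWithinAt)
      (fun t _ => (hd t).differentiableAt.differentiableWithinAt) fun t ht => ?_
    rw [interior_Icc] at ht
    rw [(hd t).deriv]
    linarith [hc t ht]
  have mono2 : MonotoneOn (fun t => f t - f' 0 * t - c / 2 * t ^ 2) (Set.Icc 0 1) := by
    have hd : ∀ t, HasDerivAt (fun t => f t - f' 0 * t - c / 2 * t ^ 2)
        (f' t - f' 0 - c * t) t := fun t => by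
      have := ((h1 t).sub ((hasDerivAt_id t).const_mul (f' 0))).sub
        ((hasDerivAt_pow 2 t).const_mul (c / 2))
      refine this.congr_deriv ?_
      simp
      ring
    refine monotoneOn_of_deriv_nonneg (convex_Icc 0 1)
      (fun t _ => (hd t).continuousAt.continuousWithinAt)
      (fun t _ => (hd t).differentiableAt.differentiableWithinAt) fun t ht => ?_
    rw [interior_Icc] at ht
    rw [(hd t).deriv]
    have := mono1 (Set.left_mem_Icc.2 zero_le_one) ⟨ht.1.le, ht.2.le⟩ ht.1.le
    simp only [mul_zero, sub_zero] at this
    linarith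
  have := mono2 (Set.left_mem_Icc.2 zero_le_one) (Set.right_mem_Icc.2 zero_le_one) zero_le_one
  norm_num at this
  linarith

/-- A convex function that lies above its tangent at `θ` by at most a quadratic function has a
derivative that is Lipschitz at `θ`. No second derivative is involved, and the increment `u` may
be of any size. -/
lemma abs_deriv_sub_le {f : ℝ → ℝ} (hf : ConvexOn ℝ Set.univ f) (hd : Differentiable ℝ f)
    {θ C : ℝ} (h : ∀ t, f (θ + t) - f θ - t * deriv f θ ≤ C * t ^ 2) (u : ℝ) :
    |deriv f (θ + u) - deriv f θ| ≤ 4 * C * |u| := by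
  -- the tangents at `θ + u` and at `θ`, evaluated at `θ + 2 u` and at `θ + u`, give the upper bound
  have h1 := tangent_le hf hd (θ + u) (θ + 2 * u)
  have h2 := tangent_le hf hd θ (θ + u)
  have h4 := tangent_le hf hd (θ + u) θ
  have h3 := h (2 * u)
  set D := deriv f (θ + u) - deriv f θ with hD
  have h5 : D * u ≤ 4 * C * u ^ 2 := by
    rw [hD]; nlinarith
  have h6 : 0 ≤ D * u := by rw [hD]; nlinarith
  rcases eq_or_ne u 0 with rfl | hu
  · simp [hD]
  · have hu' := abs_pos.2 hu
    have : |D| * |u| ≤ 4 * C * |u| * |u| := by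
      rw [← abs_mul, abs_of_nonneg h6, mul_assoc, abs_mul_abs_self]
      linarith
    exact le_of_mul_le_mul_right this hu'

/-! ### Sub-Gaussian tails -/

/-- Integration of the tail bound `2 exp (-κ ε²)`, by the layer cake formula. -/
lemma lintegral_exp_sq_le {Ω : Type*} [MeasurableSpace Ω] {μ : Measure Ω}
    [IsProbabilityMeasure μ] {Z : Ω → ℝ} (hZ : Measurable Z) {κ : ℝ} (hκ : 0 < κ)
    (htail : ∀ ε : ℝ, 0 < ε → μ {ω | ε ≤ |Z ω|} ≤ ENNReal.ofReal (2 * Real.exp (-κ * ε ^ 2))) :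
    ∫⁻ ω, ENNReal.ofReal (Real.exp (κ / 2 * Z ω ^ 2)) ∂μ ≤ 3 := by
  rw [lintegral_eq_lintegral_meas_lt μ (Eventually.of_forall fun ω => (Real.exp_pos _).le)
    (by fun_prop)]
  have hsplit : Set.Ioi (0 : ℝ) = Set.Ioc 0 1 ∪ Set.Ioi 1 := by
    rw [Set.Ioc_union_Ioi_eq_Ioi zero_le_one]
  have h1 : ∫⁻ t in Set.Ioc (0 : ℝ) 1, μ {ω | t < Real.exp (κ / 2 * Z ω ^ 2)} ≤ 1 := by
    calc _ ≤ ∫⁻ t in Set.Ioc (0 : ℝ) 1, 1 := lintegral_mono fun t => prob_le_one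
      _ = 1 := by simp
  have h2 : ∫⁻ t in Set.Ioi (1 : ℝ), μ {ω | t < Real.exp (κ / 2 * Z ω ^ 2)} ≤ 2 := by
    calc _ ≤ ∫⁻ t in Set.Ioi (1 : ℝ), ENNReal.ofReal (2 * t ^ (-2 : ℝ)) := by
          refine setLIntegral_mono' measurableSet_Ioi fun t ht => ?_
          have ht : 1 < t := ht
          have hl : 0 < Real.log t := Real.log_pos ht
          have hε : 0 < √(2 / κ * Real.log t) := Real.sqrt_pos.2 (by positivity)
          refine (measure_mono fun ω hω => ?_).trans ((htail _ hε).trans_eq ?_)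
          · have hω : t < Real.exp (κ / 2 * Z ω ^ 2) := hω
            rw [← Real.log_lt_iff_lt_exp (by linarith)] at hω
            refine Real.sqrt_le_iff.2 ⟨abs_nonneg _, ?_⟩
            rw [sq_abs]
            field_simp
            linarith
          · rw [Real.sq_sqrt (by positivity), Real.rpow_def_of_pos (by linarith)]
            congr 3
            field_simp
      _ = ENNReal.ofReal (∫ t in Set.Ioi (1 : ℝ), 2 * t ^ (-2 : ℝ)) := by
          rw [ofReal_integral_eq_lintegral_ofReal]
          · exact (integrableOn_Ioi_rpow_of_lt (by norm_num) zero_lt_one).const_mul _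
          · refine (ae_restrict_iff' measurableSet_Ioi).2 (Eventually.of_forall fun t ht => ?_)
            have ht : 1 < t := ht
            have : (0 : ℝ) < t := by linarith
            positivity
      _ = 2 := by
          rw [integral_const_mul, integral_Ioi_rpow_of_lt (by norm_num) zero_lt_one]
          norm_num
  calc _ ≤ _ := by rw [hsplit]; exact lintegral_union_le _ _ _
    _ ≤ 1 + 2 := add_le_add h1 h2
    _ = 3 := by norm_num

lemma lintegral_sq_le {Ω : Type*} [MeasurableSpace Ω] {μ : Measure Ω}
    [IsProbabilityMeasure μ] {Z : Ω → ℝ} (hZ : Measurable Z) {κ : ℝ} (hκ : 0 < κ)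
    (htail : ∀ ε : ℝ, 0 < ε → μ {ω | ε ≤ |Z ω|} ≤ ENNReal.ofReal (2 * Real.exp (-κ * ε ^ 2))) :
    ∫⁻ ω, ENNReal.ofReal (Z ω ^ 2) ∂μ ≤ ENNReal.ofReal (6 / κ) := by
  calc _ ≤ ∫⁻ ω, ENNReal.ofReal (2 / κ) * ENNReal.ofReal (Real.exp (κ / 2 * Z ω ^ 2)) ∂μ := by
        refine lintegral_mono fun ω => ?_
        rw [← ENNReal.ofReal_mul (by positivity)]
        refine ENNReal.ofReal_le_ofReal ?_
        have := Real.add_one_le_exp (κ / 2 * Z ω ^ 2)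
        rw [div_mul_eq_mul_div, le_div_iff₀ hκ]
        linarith
    _ = ENNReal.ofReal (2 / κ) * ∫⁻ ω, ENNReal.ofReal (Real.exp (κ / 2 * Z ω ^ 2)) ∂μ := by
        rw [lintegral_const_mul _ (by fun_prop)]
    _ ≤ ENNReal.ofReal (2 / κ) * 3 := by
        gcongr
        exact lintegral_exp_sq_le hZ hκ htail
    _ = ENNReal.ofReal (6 / κ) := by
        rw [show (3 : ENNReal) = ENNReal.ofReal 3 by norm_num, ← ENNReal.ofReal_mul (by positivity)]
        congr 1
        ring

/-! ### The exponential family -/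

section ExpFamily

variable {m : Measure ℝ} {c : ℝ → ℝ → ℝ} {d : ℝ → ℝ} {φ : ℝ}

/-- Exponential tilting moves the natural parameter of the family. -/
lemma lintegral_exp_glmLaw (h : IsExpFamily m c d φ) (θ t b : ℝ) :
    ∫⁻ y, ENNReal.ofReal (Real.exp (t * (y - b))) ∂glmLaw m c d φ θ =
      ENNReal.ofReal (Real.exp (d (θ + t) - d θ - t * b)) := by
  have hc := h.measurable
  have hmeas : ∀ θ, Measurable fun y => ENNReal.ofReal (glmDensity c d φ θ y) := fun θ => by
    unfold glmDensity; fun_prop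
  have htot : ∫⁻ y, ENNReal.ofReal (glmDensity c d φ (θ + t) y) ∂m = 1 := by
    have := (h.isProbability (θ + t)).measure_univ
    rwa [glmLaw, withDensity_apply _ MeasurableSet.univ, setLIntegral_univ] at this
  rw [glmLaw, lintegral_withDensity_eq_lintegral_mul _ (hmeas θ) (by fun_prop)]
  calc _ = ∫⁻ y, ENNReal.ofReal (glmDensity c d φ (θ + t) y) *
          ENNReal.ofReal (Real.exp (d (θ + t) - d θ - t * b)) ∂m := by
        refine lintegral_congr fun y => ?_
        simp only [Pi.mul_apply]
        have h0 : ∀ θ, 0 ≤ glmDensity c d φ θ y := fun θ =>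
          mul_nonneg (h.nonneg y) (Real.exp_pos _).le
        rw [← ENNReal.ofReal_mul (h0 _), ← ENNReal.ofReal_mul (h0 _)]
        congr 1
        unfold glmDensity
        rw [mul_assoc, mul_assoc, ← Real.exp_add, ← Real.exp_add]
        congr 2
        ring
    _ = _ := by rw [lintegral_mul_const _ (hmeas _), htot, one_mul]

open ProbabilityTheory in
/-- The log-partition function is, up to a constant, a cumulant generating function; hence it is
smooth and convex. -/
lemma IsExpFamily.contDiff_and_convexOn (h : IsExpFamily m c d φ) :
    ContDiff ℝ 2 d ∧ ConvexOn ℝ Set.univ d := by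
  have := h.isProbability 0
  set μ := glmLaw m c d φ 0
  have hint : ∀ t, Integrable (fun y => Real.exp (t * id y)) μ := fun t => by
    refine ⟨by fun_prop, ?_⟩
    rw [hasFiniteIntegral_iff_ofReal (Eventually.of_forall fun y => (Real.exp_pos _).le)]
    have := lintegral_exp_glmLaw h 0 t 0
    simp only [sub_zero] at this
    simp [μ, this]
  have hset : interior (integrableExpSet id μ) = Set.univ := by
    rw [interior_eq_univ]
    exact Set.eq_univ_of_forall hint
  have hcgf : d = fun t => d 0 + cgf id μ t := by
    ext t
    have := lintegral_exp_glmLaw h 0 t 0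
    simp only [sub_zero, zero_add, mul_zero] at this
    rw [cgf, mgf, integral_eq_lintegral_of_nonneg_ae
      (Eventually.of_forall fun y => (Real.exp_pos _).le) (hint t).1]
    simp only [id]
    rw [this, ENNReal.toReal_ofReal (Real.exp_pos _).le, Real.log_exp]
    ring
  have han : AnalyticOnNhd ℝ (cgf id μ) Set.univ := hset ▸ analyticOnNhd_cgf
  have hcd : ContDiff ℝ 2 (cgf id μ) := contDiffOn_univ.1 (han.contDiffOn uniqueDiffOn_univ)
  have hconv : ConvexOn ℝ Set.univ (cgf id μ) := by
    refine convexOn_of_deriv2_nonneg convex_univ hcd.continuous.continuousOn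
      (hcd.differentiable (by norm_num)).differentiableOn ?_ fun t _ => ?_
    · exact ((contDiff_succ_iff_deriv (n := 1)).1 hcd).2.2.differentiable
        (by norm_num) |>.differentiableOn
    · rw [← iteratedDeriv_eq_iterate, iteratedDeriv_two_cgf_eq_integral (by simp [hset])]
      exact div_nonneg (integral_nonneg fun y => by positivity) mgf_nonneg
  rw [hcgf]
  refine ⟨contDiff_const.add hcd, ?_⟩
  exact (convexOn_const (d 0) convex_univ).add hconv

/-- Sub-Gaussian tails of the centred response bound the growth of the log-partition function
around the natural parameter. -/
lemma logPartition_sub_le (h : IsExpFamily m c d φ) {κ : ℝ} (hκ : 0 < κ) {θ : ℝ}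
    (htail : ∀ ε : ℝ, 0 < ε → glmLaw m c d φ θ {y | ε ≤ |y - deriv d θ|} ≤
      ENNReal.ofReal (2 * Real.exp (-κ * ε ^ 2))) (t : ℝ) :
    d (θ + t) - d θ - t * deriv d θ ≤ 4 / κ * t ^ 2 := by
  have := h.isProbability θ
  obtain ⟨hcd, hconv⟩ := h.contDiff_and_convexOn
  set μ := glmLaw m c d φ θ
  set b := deriv d θ
  have hexp := lintegral_exp_sq_le (μ := μ) (Z := fun y => y - b) (by fun_prop) hκ htail
  have hF := lintegral_exp_glmLaw h θ t b
  have hF' := lintegral_exp_glmLaw h θ (-t) b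
  rcases le_or_gt (t ^ 2) κ with ht | ht
  · -- symmetrization: `exp F(t) + exp F(-t) = 2 E cosh (t Z) ≤ 2 E exp (t² Z² / 2)`
    set q := t ^ 2 / κ with hq
    have hq0 : 0 ≤ q := by positivity
    have hq1 : q ≤ 1 := (div_le_one hκ).2 ht
    have hpt : ∀ y : ℝ, Real.exp (t * (y - b)) + Real.exp (-t * (y - b)) ≤
        2 * (1 - q) + 2 * q * Real.exp (κ / 2 * (y - b) ^ 2) := by
      intro y
      have h1 := Real.cosh_le_exp_half_sq (t * (y - b))
      rw [Real.cosh_eq] at h1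
      have h2 := convexOn_exp.2 (Set.mem_univ 0) (Set.mem_univ (κ / 2 * (y - b) ^ 2))
        (sub_nonneg.2 hq1) hq0 (by ring)
      simp only [smul_eq_mul, mul_zero, zero_add, Real.exp_zero, mul_one] at h2
      rw [show q * (κ / 2 * (y - b) ^ 2) = (t * (y - b)) ^ 2 / 2 by rw [hq]; field_simp] at h2
      rw [show -t * (y - b) = -(t * (y - b)) by ring]
      linarith
    have hint : ENNReal.ofReal (Real.exp (d (θ + t) - d θ - t * b)) +
        ENNReal.ofReal (Real.exp (d (θ + -t) - d θ - -t * b)) ≤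
        ENNReal.ofReal (2 * (1 - q) + 2 * q * 3) := by
      rw [← hF, ← hF', ← lintegral_add_left (by fun_prop)]
      calc _ ≤ ∫⁻ y, (ENNReal.ofReal (2 * (1 - q)) +
            ENNReal.ofReal (2 * q) * ENNReal.ofReal (Real.exp (κ / 2 * (y - b) ^ 2))) ∂μ := by
            refine lintegral_mono fun y => ?_
            simp only []
            rw [← ENNReal.ofReal_add (Real.exp_pos _).le (Real.exp_pos _).le,
              ← ENNReal.ofReal_mul (by positivity),
              ← ENNReal.ofReal_add (by linarith) (by positivity)]
            exact ENNReal.ofReal_le_ofReal (hpt y)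
        _ = ENNReal.ofReal (2 * (1 - q)) + ENNReal.ofReal (2 * q) *
            ∫⁻ y, ENNReal.ofReal (Real.exp (κ / 2 * (y - b) ^ 2)) ∂μ := by
            rw [lintegral_add_left (by fun_prop), lintegral_const_mul _ (by fun_prop)]
            simp
        _ ≤ ENNReal.ofReal (2 * (1 - q)) + ENNReal.ofReal (2 * q) * ENNReal.ofReal 3 := by
            gcongr
            simpa using hexp
        _ = _ := by
            rw [← ENNReal.ofReal_mul (by positivity),
              ← ENNReal.ofReal_add (by linarith) (by positivity)]
    rw [← ENNReal.ofReal_add (Real.exp_pos _).le (Real.exp_pos _).le,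
      ENNReal.ofReal_le_ofReal_iff (by nlinarith)] at hint
    -- convexity makes `F(-t)` nonnegative
    have hneg : 0 ≤ d (θ + -t) - d θ - -t * b := by
      have := tangent_le hconv (hcd.differentiable (by norm_num)) θ (θ + -t)
      linarith
    have h3 := Real.one_le_exp hneg
    have h4 := Real.add_one_le_exp (4 * q)
    have h5 : Real.exp (d (θ + t) - d θ - t * b) ≤ Real.exp (4 * q) := by linarith
    have h6 := Real.exp_le_exp.1 h5
    calc _ ≤ 4 * q := h6
      _ = _ := by rw [hq]; ring
  · have hpt : ∀ y : ℝ, t * (y - b) ≤ t ^ 2 / (2 * κ) + κ / 2 * (y - b) ^ 2 := by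
      intro y
      have h0 : t ^ 2 / (2 * κ) + κ / 2 * (y - b) ^ 2 - t * (y - b) =
          (t - κ * (y - b)) ^ 2 / (2 * κ) := by
        field_simp
        ring
      have : 0 ≤ (t - κ * (y - b)) ^ 2 / (2 * κ) := by positivity
      linarith
    have hint : ENNReal.ofReal (Real.exp (d (θ + t) - d θ - t * b)) ≤
        ENNReal.ofReal (Real.exp (t ^ 2 / (2 * κ)) * 3) := by
      rw [← hF]
      calc _ ≤ ∫⁻ y, ENNReal.ofReal (Real.exp (t ^ 2 / (2 * κ))) *
            ENNReal.ofReal (Real.exp (κ / 2 * (y - b) ^ 2)) ∂μ := by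
            refine lintegral_mono fun y => ?_
            simp only []
            rw [← ENNReal.ofReal_mul (by positivity), ← Real.exp_add]
            exact ENNReal.ofReal_le_ofReal (Real.exp_le_exp.2 (hpt y))
        _ = ENNReal.ofReal (Real.exp (t ^ 2 / (2 * κ))) *
            ∫⁻ y, ENNReal.ofReal (Real.exp (κ / 2 * (y - b) ^ 2)) ∂μ := by
            rw [lintegral_const_mul _ (by fun_prop)]
        _ ≤ ENNReal.ofReal (Real.exp (t ^ 2 / (2 * κ))) * ENNReal.ofReal 3 := by
            gcongr
            simpa using hexp
        _ = _ := by rw [← ENNReal.ofReal_mul (by positivity)]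
    rw [ENNReal.ofReal_le_ofReal_iff (by positivity)] at hint
    have h3 : (3 : ℝ) ≤ Real.exp 2 := by
      have := Real.add_one_le_exp (2 : ℝ)
      linarith
    have h5 : Real.exp (d (θ + t) - d θ - t * b) ≤ Real.exp (t ^ 2 / (2 * κ) + 2) := by
      rw [Real.exp_add]
      exact hint.trans (by gcongr)
    have h6 := Real.exp_le_exp.1 h5
    have h7 : 1 ≤ t ^ 2 / κ := (one_le_div hκ).2 ht.le
    have h8 : t ^ 2 / (2 * κ) = t ^ 2 / κ / 2 := by field_simp
    have h9 : 4 / κ * t ^ 2 = 4 * (t ^ 2 / κ) := by ring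
    linarith

end ExpFamily

/-! ### Minimizers of convex functions -/

/-- A convex function that is larger on a sphere around `x₀` than at `x₀`, and strictly midpoint
convex in the ball, has a strict global minimizer, which lies in the ball. -/
lemma exists_strict_minimizer {p : ℕ} {V : Set (Fin p → ℝ)} (hV : IsClosed V)
    {f : (Fin p → ℝ) → ℝ} (hf : ConvexOn ℝ V f) (hfc : Continuous f) {x₀ : Fin p → ℝ}
    (hx₀ : x₀ ∈ V) {R : ℝ} (hR : 0 < R)
    (hsphere : ∀ b ∈ V, l2Norm (b - x₀) = R → f x₀ < f b)
    (hmid : ∀ b ∈ V, ∀ b' ∈ V, l2Norm (b - x₀) ≤ R → l2Norm (b' - x₀) ≤ R → b ≠ b' →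
      2 * f ((1 / 2 : ℝ) • b + (1 / 2 : ℝ) • b') < f b + f b') :
    ∃ b₀ ∈ V, l2Norm (b₀ - x₀) ≤ R ∧ ∀ b ∈ V, b ≠ b₀ → f b₀ < f b := by
  have hnc : Continuous fun b : Fin p → ℝ => l2Norm (b - x₀) :=
    continuous_l2Norm.comp (continuous_id.sub continuous_const)
  have hK : IsCompact (V ∩ {b | l2Norm (b - x₀) ≤ R}) := by
    refine Metric.isCompact_of_isClosed_isBounded (hV.inter (isClosed_le hnc continuous_const)) ?_
    refine (Metric.isBounded_closedBall (x := x₀) (r := R)).subset fun b hb => ?_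
    rw [Metric.mem_closedBall, dist_pi_le_iff hR.le]
    intro j
    rw [Real.dist_eq]
    exact (abs_apply_le_l2Norm (b - x₀) j).trans hb.2
  have hx₀K : x₀ ∈ V ∩ {b | l2Norm (b - x₀) ≤ R} := ⟨hx₀, by simp [hR.le]⟩
  obtain ⟨b₀, hb₀, hmin⟩ := hK.exists_isMinOn ⟨x₀, hx₀K⟩ hfc.continuousOn
  refine ⟨b₀, hb₀.1, hb₀.2, fun b hb hne => ?_⟩
  rcases le_or_gt (l2Norm (b - x₀)) R with hbR | hbR
  · have h1 := hmid b hb b₀ hb₀.1 hbR hb₀.2 hne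
    have hb2 : f b₀ ≤ f ((1 / 2 : ℝ) • b + (1 / 2 : ℝ) • b₀) := by
      refine hmin ⟨hf.1 hb hb₀.1 (by norm_num) (by norm_num) (by norm_num), ?_⟩
      have : (1 / 2 : ℝ) • b + (1 / 2 : ℝ) • b₀ - x₀ =
          (1 / 2 : ℝ) • (b - x₀) + (1 / 2 : ℝ) • (b₀ - x₀) := by
        ext j; simp; ring
      have h2 := l2Norm_add_le ((1 / 2 : ℝ) • (b - x₀)) ((1 / 2 : ℝ) • (b₀ - x₀))
      rw [l2Norm_smul, l2Norm_smul, ← this, abs_of_pos (by norm_num : (0 : ℝ) < 1 / 2)] at h2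
      have h3 : l2Norm (b₀ - x₀) ≤ R := hb₀.2
      change l2Norm _ ≤ R
      linarith
    linarith
  · -- the segment from `x₀` to a point outside of the ball crosses the sphere
    set r := l2Norm (b - x₀)
    have hr : 0 < r := hR.trans hbR
    set τ := R / r with hτ
    have hτ0 : 0 < τ := div_pos hR hr
    have hτ1 : τ ≤ 1 := ((div_lt_one hr).2 hbR).le
    have hz : (1 - τ) • x₀ + τ • b ∈ V := hf.1 hx₀ hb (by linarith) hτ0.le (by ring)
    have h1 := hsphere _ hz (by
      rw [show (1 - τ) • x₀ + τ • b - x₀ = τ • (b - x₀) by ext j; simp; ring, l2Norm_smul,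
        abs_of_pos hτ0, hτ]
      exact div_mul_cancel₀ R hr.ne')
    have h2 := hf.2 hx₀ hb (sub_nonneg.2 hτ1) hτ0.le (by ring)
    simp only [smul_eq_mul] at h2
    have h3 : f b₀ ≤ f x₀ := hmin hx₀K
    have h4 : 0 < τ * (f b - f x₀) := by linarith
    have h5 := pos_of_mul_pos_right h4 hτ0.le
    linarith

namespace Model

variable {G : ℕ} (M : Model G)

/-! ### The likelihood near the truth -/

/-- The error `y_i - d'(x_i^⊤ β^*)` of observation `i` of source `k`. -/
noncomputable def noise (d : ℝ → ℝ) (x : M.Design) (y : M.Resp) (k : Fin M.K) (i : Fin (M.n k)) :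
    ℝ :=
  y k i - deriv d (x k i ⬝ᵥ M.beta k)

/-- The derivative at `b`, in direction `v`, of the log-likelihood of source `k`. -/
noncomputable def score (d : ℝ → ℝ) (x : M.Design) (y : M.Resp) (k : Fin M.K)
    (b v : Fin M.p → ℝ) : ℝ :=
  ∑ i, (y k i - deriv d (x k i ⬝ᵥ b)) * (x k i ⬝ᵥ v)

/-- The vectors that vanish off the significant variables of subgroup `g`. -/
def suppSpace (g : Fin G) : Set (Fin M.p → ℝ) := {b | ∀ j ∉ M.A g, b j = 0}

/-- The negative log-likelihood of subgroup `g` as a function of common coefficients. -/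
noncomputable def groupLoss (d : ℝ → ℝ) (x : M.Design) (y : M.Resp) (g : Fin G)
    (b : Fin M.p → ℝ) : ℝ :=
  -∑ k ∈ M.members g, M.logLik d x y k b

/-- The number of observations in subgroup `g`. -/
def size (g : Fin G) : ℕ := ∑ k ∈ M.members g, M.n k

/-- The properties of a design that the deterministic part of the argument uses. The Lipschitz
bound on `d'` around the true natural parameters is a consequence of sub-Gaussian errors. -/
structure IsTame (d : ℝ → ℝ) (Cx c1 L : ℝ) (x : M.Design) : Prop where
  abs_le : ∀ k i j, |x k i j| ≤ Cx
  gram_le : ∀ k, ∀ v ∈ M.suppSpace (M.grp k),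
    ∑ i, (x k i ⬝ᵥ v) ^ 2 ≤ Cx * M.n k * l2Norm v ^ 2
  le_curv : ∀ k, ∀ b ∈ M.suppSpace (M.grp k), ∀ v ∈ M.suppSpace (M.grp k),
    (∀ j, |b j - M.beta k j| ≤ M.d1 / 2) →
      c1 * M.n k * l2Norm v ^ 2 ≤ ∑ i, deriv (deriv d) (x k i ⬝ᵥ b) * (x k i ⬝ᵥ v) ^ 2
  lipschitz : ∀ k i u,
    |deriv d (x k i ⬝ᵥ M.beta k + u) - deriv d (x k i ⬝ᵥ M.beta k)| ≤ L * |u|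

/-- The event on which the errors are small enough: the score of each subgroup and of each source
at the truth is bounded in the significant directions in Euclidean norm, and the score of each
source is bounded by `τ` in sup norm. -/
structure IsSmallNoise (d : ℝ → ℝ) (T τ : ℝ) (x : M.Design) (y : M.Resp) : Prop where
  group_le : ∀ g, ∑ j ∈ M.A g, (∑ k ∈ M.members g, ∑ i, x k i j * M.noise d x y k i) ^ 2 ≤
    T * M.s * M.size g
  source_le : ∀ k, ∑ j ∈ M.A (M.grp k), (∑ i, x k i j * M.noise d x y k i) ^ 2 ≤ T * M.s * M.N
  sup_le : ∀ k j, |∑ i, x k i j * M.noise d x y k i| ≤ τ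

variable {M}

lemma mem_members {g : Fin G} {k : Fin M.K} : k ∈ M.members g ↔ M.grp k = g := by
  simp [members]

lemma mem_A {g : Fin G} {j : Fin M.p} : j ∈ M.A g ↔ M.xi g j ≠ 0 := by
  simp [A, supp]

lemma xi_mem_suppSpace (g : Fin G) : M.xi g ∈ M.suppSpace g := fun j hj => by
  simpa [mem_A] using hj

lemma convex_suppSpace (g : Fin G) : Convex ℝ (M.suppSpace g) := by
  intro b hb b' hb' s t _ _ _ j hj
  simp [hb j hj, hb' j hj]

lemma isClosed_suppSpace (g : Fin G) : IsClosed (M.suppSpace g) := by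
  simp only [suppSpace, Set.ofPred_forall]
  exact isClosed_iInter fun j => isClosed_iInter fun _ =>
    isClosed_eq (continuous_apply j) continuous_const

lemma sub_mem_suppSpace {g : Fin G} {b b' : Fin M.p → ℝ} (hb : b ∈ M.suppSpace g)
    (hb' : b' ∈ M.suppSpace g) : b - b' ∈ M.suppSpace g := fun j hj => by
  simp [hb j hj, hb' j hj]

section Score

variable (d : ℝ → ℝ) (x : M.Design) (y : M.Resp) (k : Fin M.K) (b v w : Fin M.p → ℝ)

lemma score_add : M.score d x y k b (v + w) = M.score d x y k b v + M.score d x y k b w := by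
  simp only [score, dotProduct_add, mul_add, Finset.sum_add_distrib]

lemma score_smul (r : ℝ) : M.score d x y k b (r • v) = r * M.score d x y k b v := by
  simp only [score, dotProduct_smul, smul_eq_mul, Finset.mul_sum]
  exact Finset.sum_congr rfl fun i _ => by ring

/-- The score at the truth is a linear combination of the errors. -/
lemma score_truth : M.score d x y k (M.beta k) v =
    ∑ j, v j * ∑ i, x k i j * M.noise d x y k i := by
  simp only [score, noise, dotProduct, Finset.mul_sum]
  rw [Finset.sum_comm]
  exact Finset.sum_congr rfl fun j _ => Finset.sum_congr rfl fun i _ => by ring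

end Score

variable {d : ℝ → ℝ} {x : M.Design} {y : M.Resp} {Cx c1 L T τ R : ℝ}

lemma logLik_le (hd : ContDiff ℝ 2 d) (hconv : ConvexOn ℝ Set.univ d) (k : Fin M.K)
    (b b' : Fin M.p → ℝ) :
    M.logLik d x y k b' ≤ M.logLik d x y k b + M.score d x y k b (b' - b) := by
  rw [logLik, logLik, score, ← Finset.sum_add_distrib]
  refine Finset.sum_le_sum fun i _ => ?_
  have := tangent_le hconv (hd.differentiable (by norm_num)) (x k i ⬝ᵥ b) (x k i ⬝ᵥ b')
  rw [dotProduct_sub]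
  nlinarith

/-- Strong concavity of the log-likelihood near the truth. -/
lemma IsTame.logLik_le (h : M.IsTame d Cx c1 L x) (hd : ContDiff ℝ 2 d)
    (k : Fin M.K) {b b' : Fin M.p → ℝ} (hb : b ∈ M.suppSpace (M.grp k))
    (hb' : b' ∈ M.suppSpace (M.grp k)) (hbd : ∀ j, |b j - M.beta k j| ≤ M.d1 / 2)
    (hbd' : ∀ j, |b' j - M.beta k j| ≤ M.d1 / 2) :
    M.logLik d x y k b' ≤ M.logLik d x y k b + M.score d x y k b (b' - b) -
      c1 * M.n k / 2 * l2Norm (b' - b) ^ 2 := by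
  have hd1 : Differentiable ℝ d := hd.differentiable (by norm_num)
  have hd2 : Differentiable ℝ (deriv d) :=
    ((contDiff_succ_iff_deriv (n := 1)).1 hd).2.2.differentiable (by norm_num)
  have hv := sub_mem_suppSpace hb' hb
  set v := b' - b with hvdef
  have hlin : ∀ (i : Fin (M.n k)) (t : ℝ),
      HasDerivAt (fun t => x k i ⬝ᵥ b + t * (x k i ⬝ᵥ v)) (x k i ⬝ᵥ v) t := fun i t => by
    simpa using ((hasDerivAt_id t).mul_const (x k i ⬝ᵥ v)).const_add (x k i ⬝ᵥ b)
  have key := quadratic_tangent_le (c := c1 * M.n k * l2Norm v ^ 2)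
    (f := fun t => ∑ i, d (x k i ⬝ᵥ b + t * (x k i ⬝ᵥ v)))
    (f' := fun t => ∑ i, deriv d (x k i ⬝ᵥ b + t * (x k i ⬝ᵥ v)) * (x k i ⬝ᵥ v))
    (f'' := fun t => ∑ i, deriv (deriv d) (x k i ⬝ᵥ b + t * (x k i ⬝ᵥ v)) * (x k i ⬝ᵥ v) ^ 2)
    (fun t => HasDerivAt.fun_sum fun i _ => (hd1 _).hasDerivAt.comp t (hlin i t))
    (fun t => HasDerivAt.fun_sum fun i _ => by
      have := ((hd2 _).hasDerivAt.comp t (hlin i t)).mul_const (x k i ⬝ᵥ v)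
      refine this.congr_deriv ?_
      ring)
    (fun t ht => by
      have hmem : b + t • v ∈ M.suppSpace (M.grp k) := fun j hj => by simp [hb j hj, hv j hj]
      have := h.le_curv k (b + t • v) hmem v hv fun j => by
        have e : (b + t • v) j - M.beta k j =
            (1 - t) * (b j - M.beta k j) + t * (b' j - M.beta k j) := by
          simp [hvdef]; ring
        rw [e]
        refine (abs_add_le _ _).trans ?_
        rw [abs_mul, abs_mul, abs_of_pos ht.1, abs_of_pos (sub_pos.2 ht.2)]
        nlinarith [hbd j, hbd' j, ht.1, ht.2]
      simpa [dotProduct_add, dotProduct_smul] using this)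
  simp only [zero_mul, add_zero, one_mul] at key
  have e1 : ∀ i, x k i ⬝ᵥ b + x k i ⬝ᵥ v = x k i ⬝ᵥ b' := fun i => by
    rw [← dotProduct_add, hvdef, add_sub_cancel]
  simp only [e1] at key
  have e2 : M.logLik d x y k b' - M.logLik d x y k b - M.score d x y k b v =
      ∑ i, d (x k i ⬝ᵥ b) + ∑ i, deriv d (x k i ⬝ᵥ b) * (x k i ⬝ᵥ v) -
        ∑ i, d (x k i ⬝ᵥ b') := by
    simp only [logLik, score, ← Finset.sum_add_distrib, ← Finset.sum_sub_distrib]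
    refine Finset.sum_congr rfl fun i _ => ?_
    rw [← e1 i]
    ring
  linarith

lemma continuous_logLik (hd : ContDiff ℝ 2 d) (k : Fin M.K) :
    Continuous (M.logLik d x y k) := by
  have := hd.continuous
  unfold logLik dotProduct
  fun_prop

lemma groupLoss_ge (hd : ContDiff ℝ 2 d) (hconv : ConvexOn ℝ Set.univ d) (g : Fin G)
    (b b' : Fin M.p → ℝ) :
    M.groupLoss d x y g b - ∑ k ∈ M.members g, M.score d x y k b (b' - b) ≤
      M.groupLoss d x y g b' := by
  have := Finset.sum_le_sum fun k (_ : k ∈ M.members g) =>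
    logLik_le (x := x) (y := y) hd hconv k b b'
  rw [Finset.sum_add_distrib] at this
  unfold groupLoss
  linarith

lemma convexOn_groupLoss (hd : ContDiff ℝ 2 d) (hconv : ConvexOn ℝ Set.univ d) (g : Fin G) :
    ConvexOn ℝ (M.suppSpace g) (M.groupLoss d x y g) := by
  refine ⟨convex_suppSpace g, fun b _ b' _ r t hr ht hrt => ?_⟩
  set z := r • b + t • b' with hz
  have h1 := groupLoss_ge (x := x) (y := y) hd hconv g z b
  have h2 := groupLoss_ge (x := x) (y := y) hd hconv g z b'
  have e1 : b - z = t • (b - b') := by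
    ext j; simp [hz]; linear_combination (-(b j)) * hrt
  have e2 : b' - z = (-r) • (b - b') := by
    ext j; simp [hz]; linear_combination (-(b' j)) * hrt
  simp only [e1, e2, score_smul, ← Finset.mul_sum] at h1 h2
  simp only [smul_eq_mul]
  obtain rfl : t = 1 - r := by linarith
  nlinarith

lemma IsTame.groupLoss_ge (h : M.IsTame d Cx c1 L x) (hd : ContDiff ℝ 2 d) {g : Fin G}
    {b b' : Fin M.p → ℝ} (hb : b ∈ M.suppSpace g) (hb' : b' ∈ M.suppSpace g)
    (hbd : l2Norm (b - M.xi g) ≤ M.d1 / 2) (hbd' : l2Norm (b' - M.xi g) ≤ M.d1 / 2) :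
    M.groupLoss d x y g b - ∑ k ∈ M.members g, M.score d x y k b (b' - b) +
      c1 * M.size g / 2 * l2Norm (b' - b) ^ 2 ≤ M.groupLoss d x y g b' := by
  have hk : ∀ k ∈ M.members g, M.logLik d x y k b' ≤ M.logLik d x y k b +
      M.score d x y k b (b' - b) - c1 * M.n k / 2 * l2Norm (b' - b) ^ 2 := fun k hk => by
    obtain rfl := mem_members.1 hk
    exact h.logLik_le (y := y) hd k hb hb'
      (fun j => (abs_apply_le_l2Norm (b - M.xi _) j).trans hbd)
      (fun j => (abs_apply_le_l2Norm (b' - M.xi _) j).trans hbd')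
  have := Finset.sum_le_sum hk
  rw [Finset.sum_sub_distrib, Finset.sum_add_distrib, ← Finset.sum_mul, ← Finset.sum_div,
    ← Finset.mul_sum, ← Nat.cast_sum] at this
  unfold groupLoss size
  linarith

lemma IsSmallNoise.sum_score_le (hn : M.IsSmallNoise d T τ x y) {g : Fin G} {v : Fin M.p → ℝ}
    (hv : v ∈ M.suppSpace g) :
    ∑ k ∈ M.members g, M.score d x y k (M.xi g) v ≤ √(T * M.s * M.size g) * l2Norm v := by
  have e : ∑ k ∈ M.members g, M.score d x y k (M.xi g) v =
      ∑ j ∈ M.A g, (∑ k ∈ M.members g, ∑ i, x k i j * M.noise d x y k i) * v j := by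
    calc _ = ∑ k ∈ M.members g, ∑ j, v j * ∑ i, x k i j * M.noise d x y k i :=
          Finset.sum_congr rfl fun k hk => by
            obtain rfl := mem_members.1 hk
            exact score_truth d x y k v
      _ = ∑ j, (∑ k ∈ M.members g, ∑ i, x k i j * M.noise d x y k i) * v j := by
          rw [Finset.sum_comm]
          exact Finset.sum_congr rfl fun j _ => by rw [← Finset.mul_sum, mul_comm]
      _ = _ := (Finset.sum_subset (Finset.subset_univ _) fun j _ hj => by
          rw [hv j hj, mul_zero]).symm
  rw [e]
  refine (le_abs_self _).trans ((abs_sum_mul_le _ _ _).trans ?_)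
  gcongr
  · exact hn.group_le g
  · rw [l2Norm_eq_sqrt]
    exact Real.sqrt_le_sqrt (Finset.sum_le_sum_of_subset_of_nonneg (Finset.subset_univ _)
      fun j _ _ => sq_nonneg _)

/-- Existence, uniqueness and rate of the oracle estimator of one subgroup: on the sphere of
radius `R` around the truth, strong convexity beats the score. -/
lemma IsTame.exists_oracle (h : M.IsTame d Cx c1 L x) (hd : ContDiff ℝ 2 d)
    (hconv : ConvexOn ℝ Set.univ d) (hc1 : 0 < c1) (hn : M.IsSmallNoise d T τ x y) (g : Fin G)
    (hsize : 0 < M.size g) (hR : 0 < R) (hRd : R ≤ M.d1 / 2)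
    (hRT : 2 * √(T * M.s * M.size g) < c1 * M.size g * R) :
    ∃ b₀ ∈ M.suppSpace g, l2Norm (b₀ - M.xi g) ≤ R ∧
      ∀ b ∈ M.suppSpace g, b ≠ b₀ → M.groupLoss d x y g b₀ < M.groupLoss d x y g b := by
  have hsize' : (0 : ℝ) < M.size g := Nat.cast_pos.2 hsize
  have hcont : Continuous (M.groupLoss d x y g) := by
    have := fun k => continuous_logLik (M := M) (x := x) (y := y) hd k
    unfold groupLoss
    fun_prop
  refine exists_strict_minimizer (isClosed_suppSpace g) (convexOn_groupLoss hd hconv g) hcont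
    (xi_mem_suppSpace g) hR ?_ ?_
  · intro b hb hbR
    have h1 := h.groupLoss_ge (y := y) hd (xi_mem_suppSpace g) hb
      (by simp only [sub_self, l2Norm_zero]; linarith) (hbR.trans_le hRd)
    have h2 := hn.sum_score_le (sub_mem_suppSpace hb (xi_mem_suppSpace g))
    rw [hbR] at h1 h2
    nlinarith
  · intro b hb b' hb' hbR hbR' hne
    set z := (1 / 2 : ℝ) • b + (1 / 2 : ℝ) • b' with hz
    have hzm : z ∈ M.suppSpace g :=
      convex_suppSpace g hb hb' (by norm_num) (by norm_num) (by norm_num)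
    have hzR : l2Norm (z - M.xi g) ≤ R := by
      have e : z - M.xi g = (1 / 2 : ℝ) • (b - M.xi g) + (1 / 2 : ℝ) • (b' - M.xi g) := by
        ext j; simp [hz]; ring
      have h2 := l2Norm_add_le ((1 / 2 : ℝ) • (b - M.xi g)) ((1 / 2 : ℝ) • (b' - M.xi g))
      rw [l2Norm_smul, l2Norm_smul, ← e, abs_of_pos (by norm_num : (0 : ℝ) < 1 / 2)] at h2
      linarith
    have h1 := h.groupLoss_ge (y := y) hd hzm hb (hzR.trans hRd) (hbR.trans hRd)
    have h2 := h.groupLoss_ge (y := y) hd hzm hb' (hzR.trans hRd) (hbR'.trans hRd)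
    have e1 : b - z = (1 / 2 : ℝ) • (b - b') := by ext j; simp [hz]; ring
    have e2 : b' - z = (-(1 / 2) : ℝ) • (b - b') := by ext j; simp [hz]; ring
    simp only [e1, e2, score_smul, l2Norm_smul, ← Finset.mul_sum] at h1 h2
    have hpos : 0 < l2Norm (b - b') :=
      lt_of_le_of_ne (l2Norm_nonneg _) (Ne.symm (mt l2Norm_eq_zero.1 (sub_ne_zero.2 hne)))
    have h3 : 0 < c1 * M.size g / 2 * (|1 / 2| * l2Norm (b - b')) ^ 2 := by positivity
    have h4 : 0 ≤ c1 * M.size g / 2 * (|-(1 / 2)| * l2Norm (b - b')) ^ 2 := by positivity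
    linarith

end Model

namespace Model

variable {G : ℕ} {M : Model G} {d : ℝ → ℝ} {x : M.Design} {y : M.Resp} {Cx c1 L T τ R : ℝ}

/-! ### The oracle estimators -/

lemma sum_fiberwise (f : Fin M.K → ℝ) : ∑ g, ∑ k ∈ M.members g, f k = ∑ k, f k :=
  Finset.sum_fiberwise Finset.univ M.grp f

lemma lossXi_eq (Ξ : Fin G → Fin M.p → ℝ) :
    M.lossXi d x y Ξ = 1 / (M.N : ℝ) * ∑ g, M.groupLoss d x y g (Ξ g) := by
  simp only [lossXi, groupLoss, Finset.sum_neg_distrib]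
  ring

lemma loss_comp_grp (Ξ : Fin G → Fin M.p → ℝ) :
    M.loss d x y (fun k => Ξ (M.grp k)) = M.lossXi d x y Ξ := by
  rw [loss, lossXi, ← sum_fiberwise]
  congr 1
  refine Finset.sum_congr rfl fun g _ => Finset.sum_congr rfl fun k hk => ?_
  rw [mem_members.1 hk]

lemma mem_spaceG_inter_spaceB (hgrp : Function.Surjective M.grp) {B : M.Coef} :
    B ∈ M.spaceG ∩ M.spaceB ↔ ∃ Ξ ∈ M.spaceXi, B = fun k => Ξ (M.grp k) := by
  constructor
  · rintro ⟨h1, h2⟩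
    refine ⟨fun g => B (Function.surjInv hgrp g), fun g j hj => ?_, ?_⟩
    · refine h2 _ j ?_
      rw [beta, Function.surjInv_eq hgrp]
      exact hj
    · ext1 k
      exact h1 _ _ (Function.surjInv_eq hgrp _).symm
  · rintro ⟨Ξ, hΞ, rfl⟩
    refine ⟨fun k k' h => ?_, fun k j hj => hΞ _ j hj⟩
    simp only [h]

variable (M d x y) in
/-- `Ξ g` is the strict minimizer of the loss of subgroup `g` over the vectors supported on its
significant variables, for every `g`. -/
def IsGroupwiseMin (Ξ : Fin G → Fin M.p → ℝ) : Prop :=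
  ∀ g, Ξ g ∈ M.suppSpace g ∧
    ∀ b ∈ M.suppSpace g, b ≠ Ξ g → M.groupLoss d x y g (Ξ g) < M.groupLoss d x y g b

variable {Ξ₀ : Fin G → Fin M.p → ℝ}

lemma IsGroupwiseMin.lossXi_lt (h : M.IsGroupwiseMin d x y Ξ₀) (hN : 0 < M.N)
    {Ξ : Fin G → Fin M.p → ℝ} (hΞ : Ξ ∈ M.spaceXi) (hne : Ξ ≠ Ξ₀) :
    M.lossXi d x y Ξ₀ < M.lossXi d x y Ξ := by
  have hN' : (0 : ℝ) < M.N := Nat.cast_pos.2 hN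
  rw [lossXi_eq, lossXi_eq]
  refine mul_lt_mul_of_pos_left ?_ (by positivity)
  obtain ⟨g, hg⟩ := Function.ne_iff.1 hne
  refine Finset.sum_lt_sum (fun g _ => ?_) ⟨g, Finset.mem_univ g, (h g).2 _ (hΞ g) hg⟩
  rcases eq_or_ne (Ξ g) (Ξ₀ g) with e | e
  · rw [e]
  · exact ((h g).2 _ (hΞ g) e).le

lemma IsGroupwiseMin.mem_spaceXi (h : M.IsGroupwiseMin d x y Ξ₀) : Ξ₀ ∈ M.spaceXi :=
  fun g => (h g).1

lemma IsGroupwiseMin.isOracleXi_iff (h : M.IsGroupwiseMin d x y Ξ₀) (hN : 0 < M.N)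
    {Ξ : Fin G → Fin M.p → ℝ} : M.IsOracleXi d x y Ξ ↔ Ξ = Ξ₀ := by
  constructor
  · rintro ⟨h1, h2⟩
    by_contra hne
    exact absurd (h2 h.mem_spaceXi) (not_le.2 (h.lossXi_lt hN h1 hne))
  · rintro rfl
    refine ⟨h.mem_spaceXi, fun Ξ' hΞ' => ?_⟩
    rcases eq_or_ne Ξ' Ξ with rfl | e
    · exact le_refl (M.lossXi d x y Ξ')
    · exact (h.lossXi_lt hN hΞ' e).le

lemma IsGroupwiseMin.loss_lt (h : M.IsGroupwiseMin d x y Ξ₀) (hN : 0 < M.N)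
    (hgrp : Function.Surjective M.grp) {B : M.Coef} (hB : B ∈ M.spaceG ∩ M.spaceB)
    (hne : B ≠ fun k => Ξ₀ (M.grp k)) :
    M.loss d x y (fun k => Ξ₀ (M.grp k)) < M.loss d x y B := by
  obtain ⟨Ξ, hΞ, rfl⟩ := (mem_spaceG_inter_spaceB hgrp).1 hB
  rw [loss_comp_grp, loss_comp_grp]
  refine h.lossXi_lt hN hΞ ?_
  rintro rfl
  exact hne rfl

lemma IsGroupwiseMin.isOracleB_iff (h : M.IsGroupwiseMin d x y Ξ₀) (hN : 0 < M.N)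
    (hgrp : Function.Surjective M.grp) {B : M.Coef} :
    M.IsOracleB d x y B ↔ B = fun k => Ξ₀ (M.grp k) := by
  have h0 : (fun k => Ξ₀ (M.grp k)) ∈ M.spaceG ∩ M.spaceB :=
    (mem_spaceG_inter_spaceB hgrp).2 ⟨Ξ₀, h.mem_spaceXi, rfl⟩
  constructor
  · rintro ⟨h1, h2⟩
    by_contra hne
    exact absurd (h2 h0) (not_le.2 (h.loss_lt hN hgrp h1 hne))
  · rintro rfl
    refine ⟨h0, fun B hB => ?_⟩
    rcases eq_or_ne B (fun k => Ξ₀ (M.grp k)) with rfl | e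
    · exact le_refl (M.loss d x y _)
    · exact (h.loss_lt hN hgrp hB e).le

/-- First-order condition: the score of a subgroup vanishes at its oracle estimate, in the
significant directions. -/
lemma IsGroupwiseMin.sum_score_eq_zero (h : M.IsGroupwiseMin d x y Ξ₀) (hd : ContDiff ℝ 2 d)
    {g : Fin G} {v : Fin M.p → ℝ} (hv : v ∈ M.suppSpace g) :
    ∑ k ∈ M.members g, M.score d x y k (Ξ₀ g) v = 0 := by
  have hd1 : Differentiable ℝ d := hd.differentiable (by norm_num)
  have hlin : ∀ k (i : Fin (M.n k)),
      HasDerivAt (fun t : ℝ => x k i ⬝ᵥ (Ξ₀ g + t • v)) (x k i ⬝ᵥ v) 0 := fun k i => by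
    simp only [dotProduct_add, dotProduct_smul, smul_eq_mul]
    simpa using ((hasDerivAt_id (0 : ℝ)).mul_const (x k i ⬝ᵥ v)).const_add (x k i ⬝ᵥ Ξ₀ g)
  have hder : HasDerivAt (fun t : ℝ => M.groupLoss d x y g (Ξ₀ g + t • v))
      (-∑ k ∈ M.members g, M.score d x y k (Ξ₀ g) v) 0 := by
    refine HasDerivAt.fun_neg (HasDerivAt.fun_sum fun k _ => HasDerivAt.fun_sum fun i _ => ?_)
    have h1 := (hlin k i).const_mul (y k i)
    have h2 := (hd1 _).hasDerivAt.comp (0 : ℝ) (hlin k i)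
    refine (h1.sub h2).congr_deriv ?_
    simp
    ring
  have hmin : IsLocalMin (fun t : ℝ => M.groupLoss d x y g (Ξ₀ g + t • v)) 0 := by
    refine Eventually.of_forall fun t => ?_
    simp only [zero_smul, add_zero]
    rcases eq_or_ne (Ξ₀ g + t • v) (Ξ₀ g) with e | e
    · rw [e]
    · exact ((h g).2 _ (fun j hj => by simp [(h g).1 j hj, hv j hj]) e).le
  exact neg_eq_zero.1 (hmin.hasDerivAt_eq_zero hder)

/-! ### The score of a single source at the oracle estimator -/

/-- The change of the fitted means between the truth and `b` has Euclidean norm of the order of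
the distance times `√n_k`, by the Lipschitz bound on `d'`. -/
lemma IsTame.sum_drift_sq_le (h : M.IsTame d Cx c1 L x) {k : Fin M.K} {b : Fin M.p → ℝ}
    (hb : b ∈ M.suppSpace (M.grp k)) :
    ∑ i, (deriv d (x k i ⬝ᵥ b) - deriv d (x k i ⬝ᵥ M.beta k)) ^ 2 ≤
      L ^ 2 * (Cx * M.n k * l2Norm (b - M.beta k) ^ 2) := by
  calc _ ≤ ∑ i, L ^ 2 * (x k i ⬝ᵥ (b - M.beta k)) ^ 2 := by
        refine Finset.sum_le_sum fun i _ => ?_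
        have := h.lipschitz k i (x k i ⬝ᵥ (b - M.beta k))
        rw [← dotProduct_add, add_sub_cancel] at this
        calc _ = |deriv d (x k i ⬝ᵥ b) - deriv d (x k i ⬝ᵥ M.beta k)| ^ 2 := (sq_abs _).symm
          _ ≤ (L * |x k i ⬝ᵥ (b - M.beta k)|) ^ 2 := by gcongr
          _ = _ := by rw [mul_pow, sq_abs]
    _ ≤ _ := by
        rw [← Finset.mul_sum]
        gcongr
        exact h.gram_le k _ (sub_mem_suppSpace hb (xi_mem_suppSpace _))

lemma score_eq_sub_drift (k : Fin M.K) (b v : Fin M.p → ℝ) :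
    M.score d x y k b v = M.score d x y k (M.beta k) v -
      ∑ i, (deriv d (x k i ⬝ᵥ b) - deriv d (x k i ⬝ᵥ M.beta k)) * (x k i ⬝ᵥ v) := by
  rw [score, score, ← Finset.sum_sub_distrib]
  exact Finset.sum_congr rfl fun i _ => by ring

lemma IsTame.sqrt_drift_le (h : M.IsTame d Cx c1 L x) (hCx : 0 ≤ Cx) (hL : 0 ≤ L)
    {k : Fin M.K} {b : Fin M.p → ℝ} (hb : b ∈ M.suppSpace (M.grp k))
    (hbR : l2Norm (b - M.beta k) ≤ R) :
    √(∑ i, (deriv d (x k i ⬝ᵥ b) - deriv d (x k i ⬝ᵥ M.beta k)) ^ 2) ≤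
      L * √(Cx * M.n k) * R := by
  refine Real.sqrt_le_sqrt (h.sum_drift_sq_le hb) |>.trans ?_
  rw [Real.sqrt_mul (by positivity), Real.sqrt_mul (by positivity), Real.sqrt_sq hL,
    Real.sqrt_sq (l2Norm_nonneg _), mul_assoc]
  gcongr

lemma IsTame.abs_score_le_l2Norm (h : M.IsTame d Cx c1 L x) (hn : M.IsSmallNoise d T τ x y)
    (hCx : 0 ≤ Cx) (hL : 0 ≤ L) (hR : 0 ≤ R) {k : Fin M.K} {b v : Fin M.p → ℝ}
    (hb : b ∈ M.suppSpace (M.grp k)) (hbR : l2Norm (b - M.beta k) ≤ R)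
    (hv : v ∈ M.suppSpace (M.grp k)) :
    |M.score d x y k b v| ≤ (√(T * M.s * M.N) + L * Cx * M.n k * R) * l2Norm v := by
  have h1 : |M.score d x y k (M.beta k) v| ≤ √(T * M.s * M.N) * l2Norm v := by
    rw [score_truth, ← Finset.sum_subset (Finset.subset_univ (M.A (M.grp k)))
      fun j _ hj => by rw [hv j hj, zero_mul]]
    refine (abs_sum_mul_le _ _ _).trans ?_
    rw [mul_comm]
    gcongr
    · exact hn.source_le k
    · rw [l2Norm_eq_sqrt]
      exact Real.sqrt_le_sqrt (Finset.sum_le_sum_of_subset_of_nonneg (Finset.subset_univ _)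
        fun j _ _ => sq_nonneg _)
  have h2 : |∑ i, (deriv d (x k i ⬝ᵥ b) - deriv d (x k i ⬝ᵥ M.beta k)) * (x k i ⬝ᵥ v)| ≤
      L * Cx * M.n k * R * l2Norm v := by
    calc _ ≤ (L * √(Cx * M.n k) * R) * (√(Cx * M.n k) * l2Norm v) := by
          refine (abs_sum_mul_le _ _ _).trans ?_
          gcongr
          · exact h.sqrt_drift_le hCx hL hb hbR
          · refine (Real.sqrt_le_sqrt (h.gram_le k v hv)).trans_eq ?_
            rw [Real.sqrt_mul (by positivity), Real.sqrt_sq (l2Norm_nonneg _)]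
      _ = L * (√(Cx * M.n k) * √(Cx * M.n k)) * R * l2Norm v := by ring
      _ = _ := by rw [Real.mul_self_sqrt (by positivity)]; ring
  rw [score_eq_sub_drift]
  refine (abs_sub _ _).trans ?_
  linarith

lemma IsTame.abs_score_le_sum_abs (h : M.IsTame d Cx c1 L x) (hn : M.IsSmallNoise d T τ x y)
    (hCx : 0 ≤ Cx) (hL : 0 ≤ L) {k : Fin M.K} {b : Fin M.p → ℝ}
    (hb : b ∈ M.suppSpace (M.grp k)) (hbR : l2Norm (b - M.beta k) ≤ R) (v : Fin M.p → ℝ) :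
    |M.score d x y k b v| ≤ (τ + Cx * (L * √Cx * M.n k * R)) * ∑ j, |v j| := by
  set e : Fin (M.n k) → ℝ := fun i => deriv d (x k i ⬝ᵥ b) - deriv d (x k i ⬝ᵥ M.beta k) with he
  have hsum : ∑ i, |e i| ≤ L * √Cx * M.n k * R := by
    have h1 := abs_sum_mul_le Finset.univ (fun i => |e i|) (fun _ => 1)
    simp only [mul_one, sq_abs, one_pow, Finset.sum_const, Finset.card_univ, Fintype.card_fin,
      nsmul_eq_mul] at h1
    calc _ ≤ √(∑ i, e i ^ 2) * √(M.n k) := (le_abs_self _).trans h1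
      _ ≤ (L * √(Cx * M.n k) * R) * √(M.n k) := by
          gcongr
          exact h.sqrt_drift_le hCx hL hb hbR
      _ = L * √Cx * (√(M.n k) * √(M.n k)) * R := by rw [Real.sqrt_mul hCx]; ring
      _ = _ := by rw [Real.mul_self_sqrt (Nat.cast_nonneg _)]
  have e1 : M.score d x y k b v =
      ∑ j, (∑ i, x k i j * M.noise d x y k i - ∑ i, e i * x k i j) * v j := by
    have e0 : ∀ i, x k i ⬝ᵥ v = ∑ j, x k i j * v j := fun i => rfl
    rw [score_eq_sub_drift, score_truth]
    change _ - ∑ i, e i * (x k i ⬝ᵥ v) = _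
    simp only [sub_mul, Finset.sum_sub_distrib]
    congr 1
    · exact Finset.sum_congr rfl fun j _ => mul_comm _ _
    · simp only [e0, Finset.mul_sum, Finset.sum_mul]
      rw [Finset.sum_comm]
      simp only [mul_assoc]
  rw [e1, Finset.mul_sum]
  refine (Finset.abs_sum_le_sum_abs _ _).trans (Finset.sum_le_sum fun j _ => ?_)
  rw [abs_mul]
  refine mul_le_mul_of_nonneg_right ?_ (abs_nonneg _)
  refine (abs_sub _ _).trans (add_le_add (hn.sup_le k j) ?_)
  calc _ ≤ ∑ i, |e i * x k i j| := Finset.abs_sum_le_sum_abs _ _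
    _ ≤ ∑ i, Cx * |e i| := by
        refine Finset.sum_le_sum fun i _ => ?_
        rw [abs_mul, mul_comm]
        exact mul_le_mul_of_nonneg_right (h.abs_le k i j) (abs_nonneg _)
    _ ≤ _ := by
        rw [← Finset.mul_sum]
        gcongr

end Model

/-! ### Strict local minimality -/

/-- Near `0` the penalty is at least half of its tangent. -/
lemma IsPenalty.eventually_ge {ρ : ℝ → ℝ → ℝ} {a lam : ℝ} (hρ : IsPenalty ρ a) (hlam : 0 < lam) :
    ∀ᶠ t in 𝓝[≥] (0 : ℝ), lam / 2 * t ≤ ρ t lam := by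
  have hder := (hρ.differentiable lam hlam 0 Set.self_mem_Ici).hasDerivWithinAt
  rw [hρ.deriv_zero lam hlam, hasDerivWithinAt_iff_tendsto_slope] at hder
  have h1 := eventually_nhdsWithin_iff.1 (hder.eventually (eventually_gt_nhds (half_lt_self hlam)))
  refine eventually_nhdsWithin_iff.2 (h1.mono fun t ht ht0 => ?_)
  rcases eq_or_lt_of_le (show 0 ≤ t from ht0) with rfl | hpos
  · simp [hρ.zero lam hlam]
  · have h2 := ht ⟨ht0, hpos.ne'⟩
    rw [slope_def_field, hρ.zero lam hlam, sub_zero, sub_zero, lt_div_iff₀ hpos] at h2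
    exact h2.le

lemma IsPenalty.eventually_ge_comp {E : Type*} [TopologicalSpace E] {ρ : ℝ → ℝ → ℝ} {a lam : ℝ}
    (hρ : IsPenalty ρ a) (hlam : 0 < lam) {f : E → ℝ} (hf : Continuous f) (h0 : ∀ z, 0 ≤ f z)
    {z₀ : E} (hz₀ : f z₀ = 0) : ∀ᶠ z in 𝓝 z₀, lam / 2 * f z ≤ ρ (f z) lam := by
  have ht : Tendsto f (𝓝 z₀) (𝓝[≥] 0) :=
    tendsto_nhdsWithin_iff.2 ⟨by simpa [hz₀] using hf.tendsto z₀, Eventually.of_forall h0⟩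
  exact ht.eventually (hρ.eventually_ge hlam)

/-- A sum over the pairs of distinct elements of a linear order. -/
lemma sum_sum_le_two_mul_sum_Ioi {K : ℕ} {D : Fin K → Fin K → ℝ} (hsymm : ∀ k k', D k k' = D k' k)
    (hdiag : ∀ k, D k k = 0) : ∑ k, ∑ k', D k k' = 2 * ∑ k, ∑ k' ∈ Finset.Ioi k, D k k' := by
  have h := Finset.sum_sum_Ioi_add_eq_sum_sum_off_diag D
  have h1 : ∀ k, ∑ k' ∈ ({k} : Finset (Fin K))ᶜ, D k' k = ∑ k', D k k' := fun k => by
    rw [← Finset.sum_add_sum_compl {k} (fun k' => D k k')]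
    simp [hdiag, hsymm k]
  simp only [h1] at h
  rw [← h, Finset.mul_sum]
  refine Finset.sum_congr rfl fun k _ => ?_
  rw [Finset.mul_sum]
  exact Finset.sum_congr rfl fun k' _ => by rw [hsymm k' k]; ring

namespace Model

variable {G : ℕ} {M : Model G} {d : ℝ → ℝ} {x : M.Design} {y : M.Resp}
  {Ξ₀ : Fin G → Fin M.p → ℝ}

/-- The linear part of the loss at the oracle estimator. The score in the significant directions
sums to zero over a subgroup, so that only the differences within the subgroups count. -/
lemma IsGroupwiseMin.sum_score_le (h : M.IsGroupwiseMin d x y Ξ₀) (hd : ContDiff ℝ 2 d)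
    (hgrp : Function.Surjective M.grp) {u1 u2 : ℝ}
    (hs1 : ∀ k v, |M.score d x y k (Ξ₀ (M.grp k)) v| ≤ u1 * ∑ j, |v j|)
    (hs2 : ∀ k, ∀ v ∈ M.suppSpace (M.grp k),
      |M.score d x y k (Ξ₀ (M.grp k)) v| ≤ u2 * l2Norm v)
    (hu2 : 0 ≤ u2) (B : M.Coef) :
    ∑ k, M.score d x y k (Ξ₀ (M.grp k)) (B k - Ξ₀ (M.grp k)) ≤
      u1 * ∑ k, ∑ j, (if j ∈ M.A (M.grp k) then 0 else |B k j|) +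
      2 * u2 * ∑ k, ∑ k' ∈ Finset.Ioi k,
        (if M.grp k = M.grp k' then l2Norm (B k - B k') else 0) := by
  classical
  -- the part of the increment in the significant directions, and the rest
  set S : Fin M.K → Fin M.p → ℝ := fun k j =>
    if j ∈ M.A (M.grp k) then B k j - Ξ₀ (M.grp k) j else 0 with hS
  set U : Fin M.K → Fin M.p → ℝ := fun k j => if j ∈ M.A (M.grp k) then 0 else B k j with hU
  set r : Fin M.K → Fin M.K := fun k => Function.surjInv hgrp (M.grp k) with hr
  have hrg : ∀ k, M.grp (r k) = M.grp k := fun k => Function.surjInv_eq hgrp _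
  have hSmem : ∀ k, S k ∈ M.suppSpace (M.grp k) := fun k j hj => by simp [hS, hj]
  have hsplit : ∀ k, B k - Ξ₀ (M.grp k) = (S k - S (r k)) + U k + S (r k) := fun k => by
    ext j
    by_cases hj : j ∈ M.A (M.grp k)
    · simp [hS, hU, hj]
    · simp [hS, hU, hj, hrg, (h (M.grp k)).1 j hj]
  have hzero : ∑ k, M.score d x y k (Ξ₀ (M.grp k)) (S (r k)) = 0 := by
    rw [← sum_fiberwise]
    refine Finset.sum_eq_zero fun g _ => ?_
    have hg : M.grp (Function.surjInv hgrp g) = g := Function.surjInv_eq hgrp g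
    have hmem := hSmem (Function.surjInv hgrp g)
    rw [hg] at hmem
    rw [← h.sum_score_eq_zero hd hmem]
    refine Finset.sum_congr rfl fun k hk => ?_
    rw [hr]
    simp only [mem_members.1 hk]
  set D : Fin M.K → Fin M.K → ℝ := fun k k' =>
    if M.grp k = M.grp k' then l2Norm (B k - B k') else 0 with hD
  have hD0 : ∀ k k', 0 ≤ D k k' := fun k k' => by
    simp only [hD]; split_ifs <;> simp [l2Norm_nonneg]
  have hpairs : ∑ k, l2Norm (S k - S (r k)) ≤ 2 * ∑ k, ∑ k' ∈ Finset.Ioi k, D k k' := by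
    rw [← sum_sum_le_two_mul_sum_Ioi (D := D)
      (fun k k' => by simp only [hD, l2Norm_sub_comm (B k), eq_comm])
      (fun k => by simp [hD])]
    refine Finset.sum_le_sum fun k _ => ?_
    calc _ ≤ D k (r k) := by
          simp only [hD, hrg, if_true]
          refine l2Norm_mono fun j => ?_
          by_cases hj : j ∈ M.A (M.grp k) <;> simp [hS, hj, hrg]
      _ ≤ _ := Finset.single_le_sum (f := D k) (fun k' _ => hD0 k k') (Finset.mem_univ _)
  calc _ = ∑ k, (M.score d x y k (Ξ₀ (M.grp k)) (U k) +
        M.score d x y k (Ξ₀ (M.grp k)) (S k - S (r k))) := by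
        rw [← sub_zero (∑ k, _), ← hzero, ← Finset.sum_sub_distrib]
        exact Finset.sum_congr rfl fun k _ => by rw [hsplit, score_add, score_add]; ring
    _ ≤ ∑ k, (u1 * ∑ j, |U k j| + u2 * l2Norm (S k - S (r k))) := by
        refine Finset.sum_le_sum fun k _ => add_le_add ?_ ?_
        · exact (le_abs_self _).trans (hs1 k _)
        · refine (le_abs_self _).trans (hs2 k _ (sub_mem_suppSpace (hSmem k) ?_))
          have := hSmem (r k)
          rwa [hrg] at this
    _ = u1 * ∑ k, ∑ j, |U k j| + u2 * ∑ k, l2Norm (S k - S (r k)) := by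
        rw [Finset.sum_add_distrib, Finset.mul_sum, Finset.mul_sum]
    _ ≤ u1 * ∑ k, ∑ j, |U k j| + u2 * (2 * ∑ k, ∑ k' ∈ Finset.Ioi k, D k k') := by gcongr
    _ = _ := by
        have : ∀ k j, |U k j| = if j ∈ M.A (M.grp k) then 0 else |B k j| := fun k j => by
          simp only [hU]; split_ifs <;> simp
        simp only [this, hD]
        ring

/-- The oracle estimator is a strict local minimizer of the penalized objective. Where the oracle
estimator and its differences are large the penalties are locally constant; elsewhere they grow
linearly and dominate the score. -/
lemma IsGroupwiseMin.isStrictLocalMin_Q (h : M.IsGroupwiseMin d x y Ξ₀) (hd : ContDiff ℝ 2 d)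
    (hconv : ConvexOn ℝ Set.univ d) (hN : 0 < M.N) (hgrp : Function.Surjective M.grp)
    {ρ : ℝ → ℝ → ℝ} {a lam1 lam2 : ℝ} (hρ : IsPenalty ρ a) (hl1 : 0 < lam1) (hl2 : 0 < lam2)
    (hs1 : ∀ k v, |M.score d x y k (Ξ₀ (M.grp k)) v| ≤ M.N * (lam1 / 4) * ∑ j, |v j|)
    (hs2 : ∀ k, ∀ v ∈ M.suppSpace (M.grp k),
      |M.score d x y k (Ξ₀ (M.grp k)) v| ≤ M.N * (lam2 / 8) * l2Norm v)
    (hA : ∀ k, ∀ j ∈ M.A (M.grp k), a * lam1 < |Ξ₀ (M.grp k) j|)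
    (hsep : ∀ k k', M.grp k ≠ M.grp k' →
      a * lam2 < l2Norm (Ξ₀ (M.grp k) - Ξ₀ (M.grp k'))) :
    IsStrictLocalMin (M.Q d ρ lam1 lam2 x y) fun k => Ξ₀ (M.grp k) := by
  have hN' : (0 : ℝ) < M.N := Nat.cast_pos.2 hN
  set B₀ : M.Coef := fun k => Ξ₀ (M.grp k) with hB₀
  obtain ⟨K1, hK1⟩ := hρ.const lam1 hl1
  obtain ⟨K2, hK2⟩ := hρ.const lam2 hl2
  have hcoord : ∀ k j, Continuous fun B : M.Coef => |B k j| := fun k j => by fun_prop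
  have hdiff : ∀ k k', Continuous fun B : M.Coef => l2Norm (B k - B k') := fun k k' =>
    continuous_l2Norm.comp ((continuous_apply k).sub (continuous_apply k'))
  have hE1 : ∀ᶠ B in 𝓝 B₀, ∀ k j, (if j ∈ M.A (M.grp k) then 0 else lam1 / 2 * |B k j|) ≤
      ρ |B k j| lam1 - ρ |B₀ k j| lam1 := by
    refine eventually_all.2 fun k => eventually_all.2 fun j => ?_
    by_cases hj : j ∈ M.A (M.grp k)
    · filter_upwards [(hcoord k j).continuousAt.eventually (lt_mem_nhds (hA k j hj))] with B hB
      have hB : a * lam1 < |B k j| := hB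
      rw [if_pos hj, hK1 _ (by rw [abs_abs]; exact hB.le),
        hK1 _ (by rw [abs_abs]; exact (hA k j hj).le), sub_self]
    · have h0 : |B₀ k j| = 0 := by simp [hB₀, (h (M.grp k)).1 j hj]
      filter_upwards [hρ.eventually_ge_comp hl1 (hcoord k j) (fun B => abs_nonneg _) h0] with B hB
      rw [if_neg hj, h0, hρ.zero lam1 hl1, sub_zero]
      exact hB
  have hE2 : ∀ᶠ B in 𝓝 B₀, ∀ k k',
      (if M.grp k = M.grp k' then lam2 / 2 * l2Norm (B k - B k') else 0) ≤
        ρ (l2Norm (B k - B k')) lam2 - ρ (l2Norm (B₀ k - B₀ k')) lam2 := by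
    refine eventually_all.2 fun k => eventually_all.2 fun k' => ?_
    by_cases hk : M.grp k = M.grp k'
    · have h0 : l2Norm (B₀ k - B₀ k') = 0 := by simp [hB₀, hk]
      filter_upwards [hρ.eventually_ge_comp hl2 (hdiff k k') (fun B => l2Norm_nonneg _) h0]
        with B hB
      rw [if_pos hk, h0, hρ.zero lam2 hl2, sub_zero]
      exact hB
    · filter_upwards [(hdiff k k').continuousAt.eventually (lt_mem_nhds (hsep k k' hk))] with B hB
      have hB : a * lam2 < l2Norm (B k - B k') := hB
      rw [if_neg hk, hK2 _ (by rw [abs_of_nonneg (l2Norm_nonneg _)]; exact hB.le),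
        hK2 _ (by rw [abs_of_nonneg (l2Norm_nonneg _)]; exact (hsep k k' hk).le), sub_self]
  rw [IsStrictLocalMin]
  filter_upwards [nhdsWithin_le_nhds hE1, nhdsWithin_le_nhds hE2, self_mem_nhdsWithin]
    with B h1 h2 hne
  set P1 := ∑ k, ∑ j, (if j ∈ M.A (M.grp k) then 0 else |B k j|) with hP1
  set P2 := ∑ k, ∑ k' ∈ Finset.Ioi k,
    (if M.grp k = M.grp k' then l2Norm (B k - B k') else 0) with hP2
  have hpen1 : lam1 / 2 * P1 ≤ ∑ k, ∑ j, ρ |B k j| lam1 - ∑ k, ∑ j, ρ |B₀ k j| lam1 := by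
    simp only [hP1, Finset.mul_sum, ← Finset.sum_sub_distrib]
    refine Finset.sum_le_sum fun k _ => Finset.sum_le_sum fun j _ => ?_
    simpa only [mul_ite, mul_zero] using h1 k j
  have hpen2 : lam2 / 2 * P2 ≤ ∑ k, ∑ k' ∈ Finset.Ioi k, ρ (l2Norm (B k - B k')) lam2 -
      ∑ k, ∑ k' ∈ Finset.Ioi k, ρ (l2Norm (B₀ k - B₀ k')) lam2 := by
    simp only [hP2, Finset.mul_sum, ← Finset.sum_sub_distrib]
    refine Finset.sum_le_sum fun k _ => Finset.sum_le_sum fun k' _ => ?_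
    simpa only [mul_ite, mul_zero] using h2 k k'
  have hloss : M.loss d x y B₀ - (lam1 / 4 * P1 + lam2 / 4 * P2) ≤ M.loss d x y B := by
    have e1 := Finset.sum_le_sum fun k (_ : k ∈ Finset.univ) =>
      logLik_le (x := x) (y := y) hd hconv k (B₀ k) (B k)
    rw [Finset.sum_add_distrib] at e1
    have e2 := h.sum_score_le hd hgrp hs1 hs2 (by positivity) B
    have e3 : ∑ k, M.logLik d x y k (B k) ≤ ∑ k, M.logLik d x y k (B₀ k) +
        M.N * (lam1 / 4 * P1 + lam2 / 4 * P2) := by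
      refine e1.trans (add_le_add_right (e2.trans_eq ?_) _)
      ring
    have e4 := mul_le_mul_of_nonneg_left e3 (by positivity : (0 : ℝ) ≤ 1 / M.N)
    rw [mul_add, ← mul_assoc (1 / (M.N : ℝ)) (M.N : ℝ), one_div_mul_cancel hN'.ne'] at e4
    simp only [loss]
    linarith
  have hP1nn : 0 ≤ P1 := Finset.sum_nonneg fun k _ => Finset.sum_nonneg fun j _ => by
    split_ifs <;> simp
  have hP2nn : 0 ≤ P2 := Finset.sum_nonneg fun k _ => Finset.sum_nonneg fun k' _ => by
    split_ifs <;> simp [l2Norm_nonneg]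
  simp only [Q]
  by_cases hB : B ∈ M.spaceG ∩ M.spaceB
  · have := h.loss_lt hN hgrp hB hne
    nlinarith
  · -- off the oracle space one of the two penalties is strictly active
    have hpos : 0 < lam1 / 4 * P1 + lam2 / 4 * P2 := by
      by_contra hle
      have hz1 : P1 = 0 := by nlinarith
      have hz2 : P2 = 0 := by nlinarith
      refine hB ⟨?_, ?_⟩
      · have hlt : ∀ k k', k < k' → M.grp k = M.grp k' → B k = B k' := fun k k' hkk hg => by
          have h3 := (Finset.sum_eq_zero_iff_of_nonneg fun k _ => Finset.sum_nonneg fun k' _ => by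
            split_ifs <;> simp [l2Norm_nonneg]).1 hz2 k (Finset.mem_univ k)
          have h4 := (Finset.sum_eq_zero_iff_of_nonneg fun k' _ => by
            split_ifs <;> simp [l2Norm_nonneg]).1 h3 k' (Finset.mem_Ioi.2 hkk)
          rw [if_pos hg] at h4
          exact sub_eq_zero.1 (l2Norm_eq_zero.1 h4)
        intro k k' hg
        rcases lt_trichotomy k k' with hkk | rfl | hkk
        · exact hlt k k' hkk hg
        · rfl
        · exact (hlt k' k hkk hg.symm).symm
      · intro k j hj
        have h3 := (Finset.sum_eq_zero_iff_of_nonneg fun k _ => Finset.sum_nonneg fun j _ => by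
          split_ifs <;> simp).1 hz1 k (Finset.mem_univ k)
        have h4 := (Finset.sum_eq_zero_iff_of_nonneg fun j _ => by
          split_ifs <;> simp).1 h3 j (Finset.mem_univ j)
        rw [if_neg (show j ∉ M.A (M.grp k) from hj)] at h4
        exact abs_eq_zero.1 h4
    linarith

end Model

namespace Model

variable {G : ℕ} {M : Model G} {d : ℝ → ℝ} {x : M.Design} {y : M.Resp} {Cx c1 L T τ R : ℝ}

lemma d1_le (k : Fin M.K) {j : Fin M.p} (hj : j ∈ M.A (M.grp k)) : M.d1 ≤ |M.beta k j| :=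
  csInf_le ⟨0, by rintro _ ⟨k, j, _, rfl⟩; exact abs_nonneg _⟩ ⟨k, j, hj, rfl⟩

lemma d2_le {k k' : Fin M.K} (h : M.grp k ≠ M.grp k') :
    M.d2 ≤ l2Norm (M.beta k - M.beta k') :=
  csInf_le ⟨0, by rintro _ ⟨k, k', _, rfl⟩; exact l2Norm_nonneg _⟩ ⟨k, k', h, rfl⟩

lemma size_le_N (g : Fin G) : M.size g ≤ M.N :=
  Finset.sum_le_sum_of_subset (Finset.subset_univ _)

lemma n_le_N (k : Fin M.K) : M.n k ≤ M.N :=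
  Finset.single_le_sum (f := M.n) (fun _ _ => Nat.zero_le _) (Finset.mem_univ k)

lemma Nbar_le_size (g : Fin G) : M.Nbar ≤ M.size g :=
  ciInf_le (OrderBot.bddBelow _) g

lemma card_A_le_s (g : Fin G) : (M.A g).card ≤ M.s :=
  Finset.le_sup (f := fun g => (M.A g).card) (Finset.mem_univ g)

variable (M d x y) in
/-- All the claims about one outcome: the groupwise oracle estimate `Ξ` exists, is within `R` of
the truth, is a strict local minimizer of the penalized objective, and has the true supports and
the true subgroups. -/
structure IsGood (ρ : ℝ → ℝ → ℝ) (lam1 lam2 R : ℝ) (Ξ : Fin G → Fin M.p → ℝ) : Prop where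
  groupwiseMin : M.IsGroupwiseMin d x y Ξ
  dist_le : ∀ g, l2Norm (Ξ g - M.xi g) ≤ R
  isStrictLocalMin : IsStrictLocalMin (M.Q d ρ lam1 lam2 x y) fun k => Ξ (M.grp k)
  supp_eq : ∀ k, supp (Ξ (M.grp k)) = supp (M.beta k)
  ker_eq : Setoid.ker (fun k => Ξ (M.grp k)) = Setoid.ker M.grp

/-- The deterministic part of the argument: on the event of small noise, a radius `R` that is
small compared with the signals and the tuning parameters makes the outcome good. -/
lemma IsTame.exists_isGood (h : M.IsTame d Cx c1 L x) (hd : ContDiff ℝ 2 d)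
    (hconv : ConvexOn ℝ Set.univ d) (hc1 : 0 < c1) (hCx : 0 ≤ Cx) (hL : 0 ≤ L)
    (hgrp : Function.Surjective M.grp) {ρ : ℝ → ℝ → ℝ} {a lam1 lam2 : ℝ} (hρ : IsPenalty ρ a)
    (hl1 : 0 < lam1) (hl2 : 0 < lam2)
    (hn : M.IsSmallNoise d T (M.N * (lam1 / 8)) x y)
    (hN : 0 < M.N) (hsize : ∀ g, 0 < M.size g) (hR : 0 < R)
    (hRT : ∀ g, 2 * √(T * M.s * M.size g) < c1 * M.size g * R)
    (hd1 : 2 * a * lam1 < M.d1) (hd2 : 2 * a * lam2 < M.d2)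
    (hR1 : R ≤ a * lam1) (hR2 : 2 * R ≤ a * lam2)
    (hRl1 : Cx * (L * √Cx * R) ≤ lam1 / 8)
    (hT : √(T * M.s * M.N) ≤ M.N * (lam2 / 16)) (hRl2 : L * Cx * R ≤ lam2 / 16) :
    ∃ Ξ, M.IsGood d x y ρ lam1 lam2 R Ξ := by
  have hN' : (0 : ℝ) < M.N := Nat.cast_pos.2 hN
  choose Ξ hΞ1 hΞ2 hΞ3 using fun g => h.exists_oracle hd hconv hc1 hn g (hsize g) hR
    (by linarith) (hRT g)
  have hmin : M.IsGroupwiseMin d x y Ξ := fun g => ⟨hΞ1 g, hΞ3 g⟩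
  have hA : ∀ k, ∀ j ∈ M.A (M.grp k), a * lam1 < |Ξ (M.grp k) j| := fun k j hj => by
    have h1 := d1_le k hj
    have h2 := (abs_apply_le_l2Norm (Ξ (M.grp k) - M.xi (M.grp k)) j).trans (hΞ2 _)
    have h3 := abs_sub_abs_le_abs_sub (M.beta k j) (Ξ (M.grp k) j)
    rw [abs_sub_comm] at h3
    have h4 : |Ξ (M.grp k) j - M.beta k j| ≤ R := h2
    linarith
  have hsep : ∀ k k', M.grp k ≠ M.grp k' →
      a * lam2 < l2Norm (Ξ (M.grp k) - Ξ (M.grp k')) := fun k k' hk => by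
    have h1 := d2_le hk
    have e : M.beta k - M.beta k' = (Ξ (M.grp k) - Ξ (M.grp k')) +
        ((M.xi (M.grp k) - Ξ (M.grp k)) + (Ξ (M.grp k') - M.xi (M.grp k'))) := by
      ext j; simp [beta]; ring
    have h2 := l2Norm_add_le (Ξ (M.grp k) - Ξ (M.grp k'))
      ((M.xi (M.grp k) - Ξ (M.grp k)) + (Ξ (M.grp k') - M.xi (M.grp k')))
    have h3 := l2Norm_add_le (M.xi (M.grp k) - Ξ (M.grp k)) (Ξ (M.grp k') - M.xi (M.grp k'))
    rw [← e] at h2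
    rw [l2Norm_sub_comm] at h3
    have h4 := hΞ2 (M.grp k)
    have h5 := hΞ2 (M.grp k')
    linarith
  refine ⟨Ξ, hmin, hΞ2, hmin.isStrictLocalMin_Q hd hconv hN hgrp hρ hl1 hl2 ?_ ?_ hA hsep,
    fun k => ?_, ?_⟩
  · intro k v
    refine (h.abs_score_le_sum_abs hn hCx hL (hΞ1 _) (hΞ2 _) v).trans ?_
    refine mul_le_mul_of_nonneg_right ?_ (Finset.sum_nonneg fun j _ => abs_nonneg _)
    have : Cx * (L * √Cx * M.n k * R) ≤ M.N * (lam1 / 8) := by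
      calc _ = M.n k * (Cx * (L * √Cx * R)) := by ring
        _ ≤ M.N * (lam1 / 8) := by gcongr; exact n_le_N k
    linarith
  · intro k v hv
    refine (h.abs_score_le_l2Norm hn hCx hL hR.le (hΞ1 _) (hΞ2 _) hv).trans ?_
    refine mul_le_mul_of_nonneg_right ?_ (l2Norm_nonneg _)
    have : L * Cx * M.n k * R ≤ M.N * (lam2 / 16) := by
      calc _ = M.n k * (L * Cx * R) := by ring
        _ ≤ M.N * (lam2 / 16) := by gcongr; exact n_le_N k
    linarith
  · ext j
    simp only [supp, Finset.mem_filter, Finset.mem_univ, true_and]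
    constructor
    · intro hj hj'
      exact hj (hΞ1 _ j fun hm => mem_A.1 hm hj')
    · intro hj hj'
      have := hA k j (mem_A.2 hj)
      rw [hj', abs_zero] at this
      linarith
  · ext k k'
    rw [Setoid.ker_def, Setoid.ker_def]
    constructor
    · intro he
      by_contra hne
      have := hsep k k' hne
      rw [he, sub_self, l2Norm_zero] at this
      linarith
    · intro he
      simp only [he]

section IsGood

variable {ρ : ℝ → ℝ → ℝ} {lam1 lam2 : ℝ} {Ξ : Fin G → Fin M.p → ℝ}

lemma IsGood.abs_errXi_le (h : M.IsGood d x y ρ lam1 lam2 R Ξ) (hR : 0 ≤ R) :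
    |M.errXi Ξ| ≤ R := by
  rw [errXi, abs_of_nonneg (Real.iSup_nonneg fun g => l2Norm_nonneg _)]
  refine Real.iSup_le (fun g => ?_) hR
  exact (l2Norm_restrict (M.A g)
    (sub_mem_suppSpace (h.groupwiseMin g).1 (xi_mem_suppSpace g))).trans_le (h.dist_le g)

lemma IsGood.abs_errB_le (h : M.IsGood d x y ρ lam1 lam2 R Ξ) (hR : 0 ≤ R) :
    |M.errB fun k => Ξ (M.grp k)| ≤ R := by
  rw [errB, abs_of_nonneg (Real.iSup_nonneg fun k => l2Norm_nonneg _)]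
  refine Real.iSup_le (fun k => ?_) hR
  exact (l2Norm_restrict (M.A (M.grp k))
    (sub_mem_suppSpace (h.groupwiseMin _).1 (xi_mem_suppSpace _))).trans_le (h.dist_le _)

end IsGood

end Model

namespace Model

variable {G : ℕ} {M : Model G} {m : Measure ℝ} {c : ℝ → ℝ → ℝ} {d : ℝ → ℝ} {x : M.Design}

/-! ### Probability bounds given the design -/

lemma isProbabilityMeasure_respLaw (hfam : ∀ k, IsExpFamily m c d (M.phi k)) (x : M.Design) :
    IsProbabilityMeasure (M.respLaw m c d x) := by
  have : ∀ k θ, IsProbabilityMeasure (glmLaw m c d (M.phi k) θ) := fun k θ =>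
    (hfam k).isProbability θ
  unfold respLaw
  infer_instance

lemma measurable_noise (k : Fin M.K) (i : Fin (M.n k)) :
    Measurable fun z : M.Design × M.Resp => M.noise d z.1 z.2 k i := by
  unfold noise dotProduct
  have := measurable_deriv d
  fun_prop

lemma measurable_noise_right (k : Fin M.K) (i : Fin (M.n k)) :
    Measurable fun y : M.Resp => M.noise d x y k i :=
  (measurable_noise k i).comp measurable_prodMk_left

lemma measurableSet_isSmallNoise (T τ : ℝ) :
    MeasurableSet {z : M.Design × M.Resp | M.IsSmallNoise d T τ z.1 z.2} := by
  have hm := fun k i => measurable_noise (M := M) (d := d) k i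
  have e : {z : M.Design × M.Resp | M.IsSmallNoise d T τ z.1 z.2} =
      {z | ∀ g, ∑ j ∈ M.A g, (∑ k ∈ M.members g, ∑ i, z.1 k i j * M.noise d z.1 z.2 k i) ^ 2 ≤
        T * M.s * M.size g} ∩
      {z | ∀ k, ∑ j ∈ M.A (M.grp k), (∑ i, z.1 k i j * M.noise d z.1 z.2 k i) ^ 2 ≤
        T * M.s * M.N} ∩
      {z | ∀ k j, |∑ i, z.1 k i j * M.noise d z.1 z.2 k i| ≤ τ} := by
    ext z
    exact ⟨fun h => ⟨⟨h.1, h.2⟩, h.3⟩, fun h => ⟨h.1.1, h.1.2, h.2⟩⟩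
  rw [e]
  refine (MeasurableSet.inter ?_ ?_).inter ?_
  · simp only [Set.ofPred_forall]
    exact MeasurableSet.iInter fun g => measurableSet_le (by fun_prop) (by fun_prop)
  · simp only [Set.ofPred_forall]
    exact MeasurableSet.iInter fun g => measurableSet_le (by fun_prop) (by fun_prop)
  · simp only [Set.ofPred_forall]
    refine MeasurableSet.iInter fun k => MeasurableSet.iInter fun j =>
      measurableSet_le ?_ measurable_const
    have : Measurable fun z : M.Design × M.Resp => ∑ i, z.1 k i j * M.noise d z.1 z.2 k i := by
      fun_prop
    exact this.abs

section SubGaussian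

variable {κ : ℝ}

/-- The sub-Gaussian tail bound for a linear combination of the errors of a subgroup. -/
lemma SubGaussianErrors.tail_le (hsub : M.SubGaussianErrors m c d κ x)
    (hfam : ∀ k, IsExpFamily m c d (M.phi k)) (g : Fin G) (η : M.Resp)
    (hη : 0 < ∑ k ∈ M.members g, ∑ i, η k i ^ 2) {ε : ℝ} (hε : 0 < ε) :
    M.respLaw m c d x {y | √(∑ k ∈ M.members g, ∑ i, η k i ^ 2) * ε ≤
      |∑ k ∈ M.members g, ∑ i, η k i * M.noise d x y k i|} ≤
        ENNReal.ofReal (2 * Real.exp (-κ * ε ^ 2)) := by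
  have := isProbabilityMeasure_respLaw hfam x
  have h1 := hsub g η hη ε hε
  have e : ∀ y : M.Resp, ∑ k ∈ M.members g, ∑ i, η k i * M.noise d x y k i =
      ∑ k ∈ M.members g, ∑ i, η k i * (y k i - deriv d (x k i ⬝ᵥ M.xi g)) := fun y =>
    Finset.sum_congr rfl fun k hk => by
      obtain rfl := mem_members.1 hk
      rfl
  have hmeas : MeasurableSet {y : M.Resp |
      |∑ k ∈ M.members g, ∑ i, η k i * M.noise d x y k i| <
        √(∑ k ∈ M.members g, ∑ i, η k i ^ 2) * ε} := by
    have hm := fun k i => measurable_noise_right (d := d) (x := x) k i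
    have : Measurable fun y : M.Resp => ∑ k ∈ M.members g, ∑ i, η k i * M.noise d x y k i := by
      fun_prop
    exact measurableSet_lt this.abs measurable_const
  simp only [← e] at h1
  have h2 := probReal_compl_eq_one_sub (μ := M.respLaw m c d x) hmeas
  rw [← ENNReal.ofReal_toReal (measure_ne_top (M.respLaw m c d x) _)]
  refine ENNReal.ofReal_le_ofReal ?_
  change (M.respLaw m c d x).real _ ≤ _
  have e2 : {y : M.Resp | √(∑ k ∈ M.members g, ∑ i, η k i ^ 2) * ε ≤
      |∑ k ∈ M.members g, ∑ i, η k i * M.noise d x y k i|} =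
      {y : M.Resp | |∑ k ∈ M.members g, ∑ i, η k i * M.noise d x y k i| <
        √(∑ k ∈ M.members g, ∑ i, η k i ^ 2) * ε}ᶜ := by
    ext y; simp
  rw [e2, h2]
  linarith

lemma sum_sq_eq_zero_imp {g : Fin G} {η : M.Resp}
    (h : ∑ k ∈ M.members g, ∑ i, η k i ^ 2 = 0) (y : M.Resp) :
    ∑ k ∈ M.members g, ∑ i, η k i * M.noise d x y k i = 0 := by
  refine Finset.sum_eq_zero fun k hk => Finset.sum_eq_zero fun i _ => ?_
  have h1 := (Finset.sum_eq_zero_iff_of_nonneg fun k _ =>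
    Finset.sum_nonneg fun i _ => sq_nonneg (η k i)).1 h k hk
  have h2 := (Finset.sum_eq_zero_iff_of_nonneg fun i _ => sq_nonneg (η k i)).1 h1 i
    (Finset.mem_univ i)
  rw [pow_eq_zero_iff two_ne_zero] at h2
  rw [h2, zero_mul]

lemma SubGaussianErrors.measure_lt_le (hsub : M.SubGaussianErrors m c d κ x) (hκ : 0 < κ)
    (hfam : ∀ k, IsExpFamily m c d (M.phi k)) (g : Fin G) (η : M.Resp) {V τ : ℝ}
    (hV : ∑ k ∈ M.members g, ∑ i, η k i ^ 2 ≤ V) (hτ : 0 < τ) :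
    M.respLaw m c d x {y | τ < |∑ k ∈ M.members g, ∑ i, η k i * M.noise d x y k i|} ≤
        ENNReal.ofReal (2 * Real.exp (-κ * (τ ^ 2 / V))) := by
  set W := ∑ k ∈ M.members g, ∑ i, η k i ^ 2 with hW
  have hW0 : 0 ≤ W := Finset.sum_nonneg fun k _ => Finset.sum_nonneg fun i _ => sq_nonneg _
  rcases hW0.eq_or_lt with h0 | hpos
  · have : {y | τ < |∑ k ∈ M.members g, ∑ i, η k i * M.noise d x y k i|} = ∅ := by
      ext y
      simp [sum_sq_eq_zero_imp (d := d) (x := x) h0.symm y, hτ.le]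
    rw [this, measure_empty]
    exact zero_le
  · have hs : 0 < √W := Real.sqrt_pos.2 hpos
    have h1 := hsub.tail_le hfam g η hpos (div_pos hτ hs)
    rw [← hW, mul_div_cancel₀ _ hs.ne'] at h1
    refine (measure_mono (Set.ofPred_subset_ofPred.2 fun y hy => le_of_lt hy)).trans
      (h1.trans (ENNReal.ofReal_le_ofReal ?_))
    rw [div_pow, Real.sq_sqrt hW0]
    have : τ ^ 2 / V ≤ τ ^ 2 / W := by gcongr
    gcongr 2 * Real.exp ?_
    nlinarith

/-- The variance bound for a linear combination of the errors of a subgroup. -/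
lemma SubGaussianErrors.lintegral_sq_le (hsub : M.SubGaussianErrors m c d κ x) (hκ : 0 < κ)
    (hfam : ∀ k, IsExpFamily m c d (M.phi k)) (g : Fin G) (η : M.Resp) {V : ℝ}
    (hV : ∑ k ∈ M.members g, ∑ i, η k i ^ 2 ≤ V) :
    ∫⁻ y, ENNReal.ofReal ((∑ k ∈ M.members g, ∑ i, η k i * M.noise d x y k i) ^ 2)
      ∂M.respLaw m c d x ≤ ENNReal.ofReal (6 / κ * V) := by
  have := isProbabilityMeasure_respLaw hfam x
  have hm := fun k i => measurable_noise_right (d := d) (x := x) k i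
  set W := ∑ k ∈ M.members g, ∑ i, η k i ^ 2 with hW
  have hW0 : 0 ≤ W := Finset.sum_nonneg fun k _ => Finset.sum_nonneg fun i _ => sq_nonneg _
  rcases hW0.eq_or_lt with h0 | hpos
  · simp [sum_sq_eq_zero_imp (d := d) (x := x) h0.symm]
  · have hs : 0 < √W := Real.sqrt_pos.2 hpos
    have h1 := FOL.lintegral_sq_le (μ := M.respLaw m c d x)
      (Z := fun y => (∑ k ∈ M.members g, ∑ i, η k i * M.noise d x y k i) / √W)
      (by fun_prop) hκ (fun ε hε => by
        simpa only [abs_div, abs_of_pos hs, le_div_iff₀ hs, mul_comm ε] using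
          hsub.tail_le hfam g η hpos hε)
    calc _ = ∫⁻ y, ENNReal.ofReal W *
          ENNReal.ofReal (((∑ k ∈ M.members g, ∑ i, η k i * M.noise d x y k i) / √W) ^ 2)
            ∂M.respLaw m c d x := by
          refine lintegral_congr fun y => ?_
          rw [← ENNReal.ofReal_mul hW0, div_pow, Real.sq_sqrt hW0, mul_div_cancel₀ _ hpos.ne']
      _ = ENNReal.ofReal W * ∫⁻ y,
          ENNReal.ofReal (((∑ k ∈ M.members g, ∑ i, η k i * M.noise d x y k i) / √W) ^ 2)
            ∂M.respLaw m c d x := by rw [lintegral_const_mul _ (by fun_prop)]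
      _ ≤ ENNReal.ofReal W * ENNReal.ofReal (6 / κ) := by gcongr
      _ = ENNReal.ofReal (6 / κ * W) := by rw [← ENNReal.ofReal_mul hW0, mul_comm]
      _ ≤ _ := by gcongr

/-- Sub-Gaussian errors make `d'` Lipschitz around the true natural parameters. -/
lemma SubGaussianErrors.lipschitz (hsub : M.SubGaussianErrors m c d κ x) (hκ : 0 < κ)
    (hfam : ∀ k, IsExpFamily m c d (M.phi k)) (k : Fin M.K) (i : Fin (M.n k)) (u : ℝ) :
    |deriv d (x k i ⬝ᵥ M.beta k + u) - deriv d (x k i ⬝ᵥ M.beta k)| ≤ 16 / κ * |u| := by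
  classical
  have hprob : ∀ k θ, IsProbabilityMeasure (glmLaw m c d (M.phi k) θ) := fun k θ =>
    (hfam k).isProbability θ
  obtain ⟨hcd, hconv⟩ := (hfam k).contDiff_and_convexOn
  have h := logPartition_sub_le (hfam k) hκ (θ := x k i ⬝ᵥ M.beta k) fun ε hε => by
    -- the weights that select the single observation `i` of source `k`
    set η : M.Resp := Pi.single k (Pi.single i 1) with hη
    have hne : ∀ k', k' ≠ k → η k' = 0 := fun k' hk' => Pi.single_eq_of_ne hk' _
    have hk : η k = Pi.single i 1 := Pi.single_eq_same _ _
    have hkm : k ∈ M.members (M.grp k) := mem_members.2 rfl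
    have e1 : ∑ k' ∈ M.members (M.grp k), ∑ i', η k' i' ^ 2 = 1 := by
      rw [Finset.sum_eq_single_of_mem k hkm fun k' _ hk' => by simp [hne k' hk'], hk,
        Finset.sum_eq_single_of_mem i (Finset.mem_univ i) fun i' _ hi' => by simp [hi']]
      simp
    have e2 : ∀ y : M.Resp, ∑ k' ∈ M.members (M.grp k), ∑ i', η k' i' * M.noise d x y k' i' =
        M.noise d x y k i := fun y => by
      rw [Finset.sum_eq_single_of_mem k hkm fun k' _ hk' => by simp [hne k' hk'], hk,
        Finset.sum_eq_single_of_mem i (Finset.mem_univ i) fun i' _ hi' => by simp [hi']]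
      simp
    have h1 := hsub.tail_le hfam (M.grp k) η (by rw [e1]; exact one_pos) hε
    simp only [e1, e2, Real.sqrt_one, one_mul] at h1
    have hmp : MeasurePreserving (fun y : M.Resp => y k i) (M.respLaw m c d x)
        (glmLaw m c d (M.phi k) (x k i ⬝ᵥ M.beta k)) :=
      (measurePreserving_eval (fun i => glmLaw m c d (M.phi k) (x k i ⬝ᵥ M.beta k)) i).comp
        (measurePreserving_eval (fun k => Measure.pi fun i =>
          glmLaw m c d (M.phi k) (x k i ⬝ᵥ M.beta k)) k)
    rw [← hmp.measure_preimage (measurableSet_le measurable_const (by fun_prop)).nullMeasurableSet]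
    exact h1
  have h2 := abs_deriv_sub_le hconv (hcd.differentiable (by norm_num)) h u
  calc _ ≤ _ := h2
    _ = _ := by ring

end SubGaussian

end Model

/-- Markov's inequality for a real function, in the form of a ratio bound. -/
lemma measure_lt_le_of_lintegral_le {Ω : Type*} [MeasurableSpace Ω] {μ : Measure Ω} {f : Ω → ℝ}
    (hf : Measurable f) {V B q : ℝ} (hB : 0 < B)
    (h : ∫⁻ ω, ENNReal.ofReal (f ω) ∂μ ≤ ENNReal.ofReal V)
    (hVB : V ≤ q * B) : μ {ω | B < f ω} ≤ ENNReal.ofReal q := by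
  have h1 := mul_meas_ge_le_lintegral (μ := μ) (f := fun ω => ENNReal.ofReal (f ω))
    (by fun_prop) (ENNReal.ofReal B)
  have h2 : ENNReal.ofReal B * μ {ω | B < f ω} ≤ ENNReal.ofReal B * ENNReal.ofReal q := by
    calc _ ≤ ENNReal.ofReal B * μ {ω | ENNReal.ofReal B ≤ ENNReal.ofReal (f ω)} := by
          have hle : {ω | B < f ω} ⊆ {ω | ENNReal.ofReal B ≤ ENNReal.ofReal (f ω)} :=
            fun ω hω => ENNReal.ofReal_le_ofReal (le_of_lt hω)
          gcongr
      _ ≤ ENNReal.ofReal V := h1.trans h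
      _ ≤ ENNReal.ofReal (B * q) := ENNReal.ofReal_le_ofReal (by linarith)
      _ = _ := ENNReal.ofReal_mul hB.le
  exact (ENNReal.mul_le_mul_iff_right (by simpa using hB) ENNReal.ofReal_ne_top).1 h2

namespace Model

variable {G : ℕ} {M : Model G} {m : Measure ℝ} {c : ℝ → ℝ → ℝ} {d : ℝ → ℝ} {x : M.Design}
  {Cx c1 C1 C2 C3 κ : ℝ}

open Matrix in
lemma matA_mulVec (k : Fin M.K) {v : Fin M.p → ℝ} (hv : v ∈ M.suppSpace (M.grp k)) :
    M.matA x k *ᵥ (fun j => v j) = fun i => x k i ⬝ᵥ v := by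
  ext i
  simp only [matA, cols, mat, Matrix.mulVec, dotProduct, Matrix.submatrix_apply, id,
    Matrix.of_apply]
  rw [← Finset.sum_subset (Finset.subset_univ (M.A (M.grp k)))
    fun j _ hj => by rw [hv j hj, mul_zero]]
  exact Finset.sum_coe_sort (M.A (M.grp k)) fun j => x k i j * v j

lemma sum_sq_restrict (k : Fin M.K) {v : Fin M.p → ℝ} (hv : v ∈ M.suppSpace (M.grp k)) :
    ∑ j : {j // j ∈ M.A (M.grp k)}, v j ^ 2 = l2Norm v ^ 2 := by
  rw [← l2Norm_restrict (M.A (M.grp k)) hv, l2Norm_sq]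

lemma Regular.isTame (h : M.Regular m c d Cx c1 C1 C2 κ C3 x) (hκ : 0 < κ)
    (hfam : ∀ k, IsExpFamily m c d (M.phi k)) : M.IsTame d Cx c1 (16 / κ) x where
  abs_le := h.1.1
  gram_le k v hv := by
    have h1 := h.1.2 k
    rw [← Matrix.mul_one (M.matA x k).transpose, ← Matrix.diagonal_one] at h1
    have h2 := h1.quadForm_le (isHermitian_gram _ _) fun j => v j
    rw [quadForm_gram, matA_mulVec k hv, sum_sq_restrict k hv] at h2
    simpa using h2
  le_curv k b hb v hv hbd := by
    have h1 := (h.2.1 k (fun j => b j) fun j => hbd j).1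
    have h2 := h1.quadForm_le (isHermitian_gram _ _) fun j => v j
    rw [quadForm_gram, matA_mulVec k hv, matA_mulVec k hb, sum_sq_restrict k hv] at h2
    simpa [iteratedDeriv_succ, iteratedDeriv_zero] using h2
  lipschitz := h.2.2.1.lipschitz hκ hfam

section Single

variable (x) in
/-- The weights that select covariate `j` of source `k`. -/
def sourceWeight (k : Fin M.K) (j : Fin M.p) : M.Resp := fun k' i =>
  if k' = k then x k' i j else 0

lemma sum_sourceWeight_mul (k : Fin M.K) (j : Fin M.p) (e : M.Resp) :
    ∑ k' ∈ M.members (M.grp k), ∑ i, sourceWeight x k j k' i * e k' i =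
      ∑ i, x k i j * e k i := by
  rw [Finset.sum_eq_single_of_mem k (mem_members.2 rfl) fun k' _ hk' => by
    simp [sourceWeight, hk']]
  simp [sourceWeight]

lemma sum_sq_covariate_le (hx : ∀ k i j, |x k i j| ≤ Cx) (k : Fin M.K) (j : Fin M.p) :
    ∑ i, x k i j ^ 2 ≤ Cx ^ 2 * M.n k := by
  calc _ ≤ ∑ i : Fin (M.n k), Cx ^ 2 := Finset.sum_le_sum fun i _ => by
        rw [← sq_abs]
        have := hx k i j
        gcongr
    _ = _ := by simp [mul_comm]

lemma sum_sq_sourceWeight_le (hx : ∀ k i j, |x k i j| ≤ Cx) (k : Fin M.K) (j : Fin M.p) :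
    ∑ k' ∈ M.members (M.grp k), ∑ i, sourceWeight x k j k' i ^ 2 ≤ Cx ^ 2 * M.n k := by
  simp only [pow_two (sourceWeight x k j _ _)]
  rw [sum_sourceWeight_mul k j (sourceWeight x k j)]
  simpa [sourceWeight, pow_two] using sum_sq_covariate_le hx k j

end Single

/-- Given a regular design the errors are small, up to the probability of two Markov bounds and
of a union bound over all sources and covariates. -/
lemma SubGaussianErrors.measure_not_isSmallNoise_le (hsub : M.SubGaussianErrors m c d κ x)
    (hκ : 0 < κ) (hCx : 0 < Cx) (hx : ∀ k i j, |x k i j| ≤ Cx)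
    (hfam : ∀ k, IsExpFamily m c d (M.phi k)) (hs : 0 < M.s) (hN : 0 < M.N)
    (hsize : ∀ g, 0 < M.size g) {T τ : ℝ} (hT : 0 < T) (hτ : 0 < τ) :
    M.respLaw m c d x {y | ¬M.IsSmallNoise d T τ x y} ≤
      ENNReal.ofReal (G * (6 / κ * Cx ^ 2 / T)) + ENNReal.ofReal (6 / κ * Cx ^ 2 / T) +
        ENNReal.ofReal (M.p * M.K * (2 * Real.exp (-κ * (τ ^ 2 / (Cx ^ 2 * M.N))))) := by
  have := isProbabilityMeasure_respLaw hfam x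
  have hm := fun k i => measurable_noise_right (d := d) (x := x) k i
  have hs' : (0 : ℝ) < M.s := Nat.cast_pos.2 hs
  have hN' : (0 : ℝ) < M.N := Nat.cast_pos.2 hN
  have hq : 0 ≤ 6 / κ * Cx ^ 2 / T := by positivity
  have hcard : ∀ g, ((M.A g).card : ENNReal) ≤ ENNReal.ofReal M.s := fun g => by
    rw [ENNReal.ofReal_natCast]
    exact Nat.cast_le.2 (card_A_le_s g)
  set f1 : Fin G → M.Resp → ℝ := fun g y =>
    ∑ j ∈ M.A g, (∑ k ∈ M.members g, ∑ i, x k i j * M.noise d x y k i) ^ 2 with hf1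
  set f2 : Fin M.K → M.Resp → ℝ := fun k y =>
    ∑ j ∈ M.A (M.grp k), (∑ i, x k i j * M.noise d x y k i) ^ 2 with hf2
  set f3 : Fin M.K → Fin M.p → M.Resp → ℝ := fun k j y =>
    ∑ i, x k i j * M.noise d x y k i with hf3
  have hb1 : ∀ g, M.respLaw m c d x {y | T * M.s * M.size g < f1 g y} ≤
      ENNReal.ofReal (6 / κ * Cx ^ 2 / T) := fun g => by
    have hg : (0 : ℝ) < M.size g := Nat.cast_pos.2 (hsize g)
    refine measure_lt_le_of_lintegral_le (V := M.s * (6 / κ * (Cx ^ 2 * M.size g)))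
      (by fun_prop) (by positivity) ?_ (le_of_eq (by field_simp))
    calc _ = ∑ j ∈ M.A g, ∫⁻ y, ENNReal.ofReal
          ((∑ k ∈ M.members g, ∑ i, x k i j * M.noise d x y k i) ^ 2) ∂M.respLaw m c d x := by
          rw [← lintegral_finsetSum _ fun j _ => by fun_prop]
          exact lintegral_congr fun y => ENNReal.ofReal_sum_of_nonneg fun j _ => sq_nonneg _
      _ ≤ ∑ j ∈ M.A g, ENNReal.ofReal (6 / κ * (Cx ^ 2 * M.size g)) := by
          refine Finset.sum_le_sum fun j _ =>
            hsub.lintegral_sq_le hκ hfam g (fun k i => x k i j) ?_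
          rw [size, Nat.cast_sum, Finset.mul_sum]
          exact Finset.sum_le_sum fun k _ => sum_sq_covariate_le hx k j
      _ ≤ ENNReal.ofReal M.s * ENNReal.ofReal (6 / κ * (Cx ^ 2 * M.size g)) := by
          rw [Finset.sum_const, nsmul_eq_mul]
          gcongr
          exact hcard g
      _ = _ := (ENNReal.ofReal_mul hs'.le).symm
  have hb2 : M.respLaw m c d x {y | T * M.s * M.N < ∑ k, f2 k y} ≤
      ENNReal.ofReal (6 / κ * Cx ^ 2 / T) := by
    refine measure_lt_le_of_lintegral_le (V := M.s * (6 / κ * (Cx ^ 2 * M.N)))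
      (by fun_prop) (by positivity) ?_ (le_of_eq (by field_simp))
    calc _ = ∑ k, ∑ j ∈ M.A (M.grp k), ∫⁻ y, ENNReal.ofReal
          ((∑ i, x k i j * M.noise d x y k i) ^ 2) ∂M.respLaw m c d x := by
          have e : ∀ y, ENNReal.ofReal (∑ k, f2 k y) = ∑ k, ENNReal.ofReal (f2 k y) := fun y =>
            ENNReal.ofReal_sum_of_nonneg fun k _ => Finset.sum_nonneg fun j _ => sq_nonneg _
          simp only [e]
          rw [lintegral_finsetSum _ fun k _ => by fun_prop]
          refine Finset.sum_congr rfl fun k _ => ?_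
          rw [← lintegral_finsetSum _ fun j _ => by fun_prop]
          exact lintegral_congr fun y => ENNReal.ofReal_sum_of_nonneg fun j _ => sq_nonneg _
      _ ≤ ∑ k, ∑ j ∈ M.A (M.grp k), ENNReal.ofReal (6 / κ * (Cx ^ 2 * M.n k)) := by
          refine Finset.sum_le_sum fun k _ => Finset.sum_le_sum fun j _ => ?_
          have := hsub.lintegral_sq_le hκ hfam (M.grp k) (sourceWeight x k j)
            (sum_sq_sourceWeight_le hx k j)
          simpa only [sum_sourceWeight_mul k j (M.noise d x _)] using this
      _ ≤ ∑ k, ENNReal.ofReal (M.s * (6 / κ * (Cx ^ 2 * M.n k))) := by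
          refine Finset.sum_le_sum fun k _ => ?_
          rw [Finset.sum_const, nsmul_eq_mul, ENNReal.ofReal_mul hs'.le]
          gcongr
          exact hcard _
      _ = _ := by
          rw [← ENNReal.ofReal_sum_of_nonneg fun k _ => by positivity]
          simp only [← Finset.mul_sum, N, Nat.cast_sum]
  have hb3 : ∀ k j, M.respLaw m c d x {y | τ < |f3 k j y|} ≤
      ENNReal.ofReal (2 * Real.exp (-κ * (τ ^ 2 / (Cx ^ 2 * M.N)))) := fun k j => by
    have hV : Cx ^ 2 * (M.n k : ℝ) ≤ Cx ^ 2 * M.N := by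
      gcongr
      exact n_le_N k
    have := hsub.measure_lt_le hκ hfam (M.grp k) (sourceWeight x k j)
      ((sum_sq_sourceWeight_le hx k j).trans hV) hτ
    simpa only [sum_sourceWeight_mul k j (M.noise d x _)] using this
  have hcover : {y | ¬M.IsSmallNoise d T τ x y} ⊆
      (⋃ g, {y | T * M.s * M.size g < f1 g y}) ∪ {y | T * M.s * M.N < ∑ k, f2 k y} ∪
        ⋃ k, ⋃ j, {y | τ < |f3 k j y|} := by
    intro y hy
    by_contra hnot
    simp only [Set.mem_union, Set.mem_iUnion, Set.mem_ofPred_eq, not_or, not_exists, not_lt]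
      at hnot
    refine hy ⟨hnot.1.1, fun k => le_trans ?_ hnot.1.2, hnot.2⟩
    exact Finset.single_le_sum (f := fun k => f2 k y)
      (fun k _ => Finset.sum_nonneg fun j _ => sq_nonneg _) (Finset.mem_univ k)
  refine (measure_mono hcover).trans ((measure_union_le _ _).trans (add_le_add
    ((measure_union_le _ _).trans (add_le_add ?_ hb2)) ?_))
  · refine (measure_iUnion_fintype_le _ _).trans ((Finset.sum_le_sum fun g _ => hb1 g).trans ?_)
    rw [Finset.sum_const, nsmul_eq_mul, ENNReal.ofReal_mul (Nat.cast_nonneg G)]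
    simp
  · refine (measure_iUnion_fintype_le _ _).trans ((Finset.sum_le_sum fun k _ =>
      (measure_iUnion_fintype_le _ _).trans (Finset.sum_le_sum fun j _ => hb3 k j)).trans ?_)
    rw [Finset.sum_const, Finset.sum_const, nsmul_eq_mul, nsmul_eq_mul, ← mul_assoc,
      ENNReal.ofReal_mul (p := (M.p : ℝ) * M.K) (by positivity),
      ENNReal.ofReal_mul (Nat.cast_nonneg _), ENNReal.ofReal_natCast, ENNReal.ofReal_natCast,
      Finset.card_univ, Finset.card_univ, Fintype.card_fin, Fintype.card_fin,
      mul_comm (M.K : ENNReal)]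

/-- A bound given each regular design holds unconditionally, up to the probability of an
irregular design. The set of regular designs need not be measurable. -/
lemma IsData.measure_le {Ω : Type*} [MeasurableSpace Ω] {P : Measure Ω} [IsProbabilityMeasure P]
    {X : Ω → M.Design} {Y : Ω → M.Resp} (hdata : M.IsData m c d P X Y)
    (hfam : ∀ k, IsExpFamily m c d (M.phi k)) {S : Set (M.Design × M.Resp)}
    (hS : MeasurableSet S) {D : Set M.Design} {q : ENNReal}
    (h : ∀ x ∈ D, M.respLaw m c d x {y | (x, y) ∈ S} ≤ q) :
    P {ω | (X ω, Y ω) ∈ S} ≤ q + P {ω | X ω ∈ D}ᶜ := by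
  rw [hdata.2.2 S hS]
  set E := toMeasurable P {ω | X ω ∈ D}ᶜ with hE
  calc _ ≤ ∫⁻ ω, (q + E.indicator (fun _ => 1) ω) ∂P := by
        refine lintegral_mono fun ω => ?_
        simp only []
        by_cases hω : X ω ∈ D
        · exact (h _ hω).trans le_self_add
        · have hmem : ω ∈ E := subset_toMeasurable P _ hω
          have := isProbabilityMeasure_respLaw hfam (X ω)
          rw [Set.indicator_of_mem hmem]
          exact prob_le_one.trans le_add_self
    _ = q + P E := by
        rw [lintegral_add_left measurable_const,
          lintegral_indicator (measurableSet_toMeasurable _ _)]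
        simp [E]
    _ = _ := by rw [hE, measure_toMeasurable]

end Model

namespace Model

variable {G : ℕ} {M : Model G} {m : Measure ℝ} {c : ℝ → ℝ → ℝ} {d : ℝ → ℝ}
  {Cx c1 C1 C2 C3 κ : ℝ}

/-! ### The probability of a good outcome -/

lemma p_pos (hs : 0 < M.s) : 0 < M.p := by
  by_contra h
  have hp : M.p = 0 := by omega
  have : ∀ g, (M.A g).card = 0 := fun g => by
    have := (Finset.card_le_univ (M.A g)).trans_eq (Fintype.card_fin M.p)
    omega
  simp [s, this] at hs

/-- A tail bound of order `exp (-Λ (log (p K) + 1))` survives a union over `p K` events. -/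
lemma mul_two_mul_exp_le {n Λ e : ℝ} (hn : 1 ≤ n) (hΛ : 1 ≤ Λ)
    (he : Λ * (Real.log n + 1) ≤ e) : n * (2 * Real.exp (-e)) ≤ 2 * Real.exp (-Λ) := by
  have h0 : 0 < n := by linarith
  have hlog := Real.log_nonneg hn
  have h1 : Real.exp (-e) ≤ Real.exp (-Λ) / n := by
    rw [le_div_iff₀ h0]
    calc _ = Real.exp (-e) * Real.exp (Real.log n) := by rw [Real.exp_log h0]
      _ = Real.exp (-e + Real.log n) := (Real.exp_add _ _).symm
      _ ≤ _ := Real.exp_le_exp.2 (by nlinarith)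
  calc _ = 2 * (n * Real.exp (-e)) := by ring
    _ ≤ 2 * (n * (Real.exp (-Λ) / n)) := by gcongr
    _ = _ := by rw [mul_div_cancel₀ _ h0.ne']

/-- With tuning parameters that exceed their critical orders by a large enough factor `H`, an
outcome is good at the radius `(3 √T / c₁) √(s / N̄)`, up to a small probability. -/
lemma IsData.measure_not_isGood_le {Ω : Type*} [MeasurableSpace Ω] {P : Measure Ω}
    [IsProbabilityMeasure P] {X : Ω → M.Design} {Y : Ω → M.Resp}
    (hdata : M.IsData m c d P X Y) (hfam : ∀ k, IsExpFamily m c d (M.phi k))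
    (hgrp : Function.Surjective M.grp) (hG : 0 < G) (hCx : 0 < Cx) (hc1 : 0 < c1) (hκ : 0 < κ)
    {ρ : ℝ → ℝ → ℝ} {a lam1 lam2 : ℝ} (ha : 0 < a) (hρ : IsPenalty ρ a)
    (hd1 : 2 * a * lam1 < M.d1) (hd2 : 2 * a * lam2 < M.d2) (hs : 0 < M.s) (hNbar : 0 < M.Nbar)
    {T Λ H D : ℝ} (hT : 0 < T) (hΛ : 1 ≤ Λ) (hD : D = 3 * √T / c1)
    (hH : 1 + 2 * (D / a) + 8 * (Cx * (16 / κ * √Cx * D)) + 16 * √T +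
      16 * (16 / κ * Cx * D) + 64 * Cx ^ 2 * Λ / κ ≤ H)
    (hlam1 : H * √((Real.log (M.p * M.K) + M.s) / M.Nbar) ≤ lam1)
    (hlam2 : H * √(M.s / M.Nbar) ≤ lam2) :
    P {ω | ¬∃ Ξ, M.IsGood d (X ω) (Y ω) ρ lam1 lam2 (D * √(M.s / M.Nbar)) Ξ} ≤
      ENNReal.ofReal (G * (6 / κ * Cx ^ 2 / T)) + ENNReal.ofReal (6 / κ * Cx ^ 2 / T) +
        ENNReal.ofReal (2 * Real.exp (-Λ)) +
        P {ω | M.Regular m c d Cx c1 C1 C2 κ C3 (X ω)}ᶜ +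
        P {ω | M.Regular m c d Cx c1 C1 C2 κ C3 (X ω)}ᶜ := by
  have hs' : (1 : ℝ) ≤ M.s := Nat.one_le_cast.2 hs
  have hNb' : (0 : ℝ) < M.Nbar := Nat.cast_pos.2 hNbar
  have hsize : ∀ g, 0 < M.size g := fun g => hNbar.trans_le (Nbar_le_size g)
  have hNbN : M.Nbar ≤ M.N := (Nbar_le_size ⟨0, hG⟩).trans (size_le_N _)
  have hNbN' : (M.Nbar : ℝ) ≤ M.N := Nat.cast_le.2 hNbN
  have hN : 0 < M.N := hNbar.trans_le hNbN
  have hN' : (0 : ℝ) < M.N := Nat.cast_pos.2 hN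
  obtain ⟨k0, -⟩ := hgrp ⟨0, hG⟩
  obtain ⟨hcd, hconv⟩ := (hfam k0).contDiff_and_convexOn
  have hpK : (1 : ℝ) ≤ M.p * M.K := by
    have h1 : (1 : ℝ) ≤ M.p := Nat.one_le_cast.2 (p_pos hs)
    have h2 : (1 : ℝ) ≤ M.K := Nat.one_le_cast.2 k0.pos
    nlinarith
  have hlog := Real.log_nonneg hpK
  set r := √(M.s / M.Nbar) with hr
  set q := √((Real.log (M.p * M.K) + M.s) / M.Nbar) with hq
  have hr0 : 0 < r := Real.sqrt_pos.2 (by positivity)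
  have hrq : r ≤ q := Real.sqrt_le_sqrt (by gcongr; linarith)
  have hsT : 0 < √T := Real.sqrt_pos.2 hT
  have hD0 : 0 < D := by rw [hD]; positivity
  -- the factor `H` exceeds each of the constants that are needed
  have t1 : 0 < D / a := by positivity
  have t2 : 0 < Cx * (16 / κ * √Cx * D) := by positivity
  have t3 : 0 < 16 / κ * Cx * D := by positivity
  have t4 : 0 < 64 * Cx ^ 2 * Λ / κ := by positivity
  have hH1 : 1 ≤ H := by linarith
  have hHr1 : ∀ z, z ≤ H → z * r ≤ lam1 := fun z hz =>
    (mul_le_mul hz hrq hr0.le (by linarith)).trans hlam1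
  have hHr2 : ∀ z, z ≤ H → z * r ≤ lam2 := fun z hz =>
    (mul_le_mul_of_nonneg_right hz hr0.le).trans hlam2
  have hl1 : 0 < lam1 := lt_of_lt_of_le (by linarith) (hHr1 1 hH1)
  have hl2 : 0 < lam2 := lt_of_lt_of_le (by linarith) (hHr2 1 hH1)
  have hsub : {ω | ¬∃ Ξ, M.IsGood d (X ω) (Y ω) ρ lam1 lam2 (D * r) Ξ} ⊆
      {ω | (X ω, Y ω) ∈ {z : M.Design × M.Resp |
        M.IsSmallNoise d T (M.N * (lam1 / 8)) z.1 z.2}ᶜ} ∪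
      {ω | M.Regular m c d Cx c1 C1 C2 κ C3 (X ω)}ᶜ := by
    intro ω hω
    by_contra hnot
    rw [Set.mem_union, not_or] at hnot
    have hn : M.IsSmallNoise d T (M.N * (lam1 / 8)) (X ω) (Y ω) := not_not.1 hnot.1
    have hreg : M.Regular m c d Cx c1 C1 C2 κ C3 (X ω) := not_not.1 hnot.2
    refine hω ((hreg.isTame hκ hfam).exists_isGood hcd hconv hc1 hCx.le (by positivity) hgrp hρ
      hl1 hl2 hn hN hsize (by positivity) (fun g => ?_) hd1 hd2 ?_ ?_ ?_ ?_ ?_)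
    · have hg : (0 : ℝ) < M.size g := Nat.cast_pos.2 (hsize g)
      have hNg : (M.Nbar : ℝ) ≤ M.size g := Nat.cast_le.2 (Nbar_le_size g)
      have e1 : √(T * M.s * M.size g) = √T * (M.size g * √(M.s / M.size g)) := by
        rw [mul_assoc, Real.sqrt_mul hT.le]
        congr 1
        rw [Real.sqrt_eq_iff_mul_self_eq_of_pos (by positivity)]
        rw [mul_mul_mul_comm, Real.mul_self_sqrt (by positivity)]
        field_simp
      have e2 : √(M.s / M.size g) ≤ r := Real.sqrt_le_sqrt (by gcongr)
      have e3 : c1 * M.size g * (D * r) = 3 * (√T * (M.size g * r)) := by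
        rw [hD]; field_simp
      rw [e1, e3]
      have e4 : √T * (M.size g * √(M.s / M.size g)) ≤ √T * (M.size g * r) := by gcongr
      have e5 : 0 < √T * (M.size g * r) := by positivity
      linarith
    · have := hHr1 (D / a) (by linarith)
      rw [div_mul_eq_mul_div, div_le_iff₀ ha] at this
      linarith
    · have := hHr2 (2 * (D / a)) (by linarith)
      rw [mul_assoc, div_mul_eq_mul_div, mul_div_assoc', div_le_iff₀ ha] at this
      linarith
    · have := hHr1 (8 * (Cx * (16 / κ * √Cx * D))) (by linarith)
      linarith
    · have h1 := hHr2 (16 * √T) (by linarith)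
      have e1 : √(T * M.s * M.N) = M.N * (√T * √(M.s / M.N)) := by
        rw [← Real.sqrt_mul hT.le, Real.sqrt_eq_iff_mul_self_eq_of_pos (by positivity),
          mul_mul_mul_comm, Real.mul_self_sqrt (by positivity)]
        field_simp
      have e2 : √(M.s / M.N) ≤ r := Real.sqrt_le_sqrt (by gcongr)
      rw [e1]
      have e3 : √T * √(M.s / M.N) ≤ √T * r := by gcongr
      gcongr
      linarith
    · have := hHr2 (16 * (16 / κ * Cx * D)) (by linarith)
      linarith
  have hτ : 0 < M.N * (lam1 / 8) := by positivity
  have hexp : M.p * M.K * (2 * Real.exp (-κ * ((M.N * (lam1 / 8)) ^ 2 / (Cx ^ 2 * M.N)))) ≤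
      2 * Real.exp (-Λ) := by
    rw [neg_mul]
    refine mul_two_mul_exp_le hpK hΛ ?_
    have hq2 : q ^ 2 * M.Nbar = Real.log (M.p * M.K) + M.s := by
      rw [hq, Real.sq_sqrt (by positivity), div_mul_cancel₀ _ hNb'.ne']
    have hH0 : 64 * Cx ^ 2 * Λ / κ ≤ H ^ 2 := by nlinarith
    rw [div_le_iff₀ hκ] at hH0
    have h1 : H ^ 2 * (Real.log (M.p * M.K) + 1) ≤ lam1 ^ 2 * M.N := by
      calc _ ≤ H ^ 2 * (q ^ 2 * M.Nbar) := by rw [hq2]; gcongr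
        _ = (H * q) ^ 2 * M.Nbar := by ring
        _ ≤ lam1 ^ 2 * M.N := by gcongr
    have e : κ * ((M.N * (lam1 / 8)) ^ 2 / (Cx ^ 2 * M.N)) =
        κ * (lam1 ^ 2 * M.N) / (64 * Cx ^ 2) := by
      field_simp
      norm_num
    rw [e, le_div_iff₀ (by positivity)]
    calc _ = 64 * Cx ^ 2 * Λ * (Real.log (M.p * M.K) + 1) := by ring
      _ ≤ H ^ 2 * κ * (Real.log (M.p * M.K) + 1) := by gcongr
      _ = κ * (H ^ 2 * (Real.log (M.p * M.K) + 1)) := by ring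
      _ ≤ _ := by gcongr
  refine (measure_mono hsub).trans ((measure_union_le _ _).trans (add_le_add_left ?_ _))
  refine hdata.measure_le hfam (measurableSet_isSmallNoise _ _).compl
    (D := {x | M.Regular m c d Cx c1 C1 C2 κ C3 x}) fun x hx => ?_
  refine (SubGaussianErrors.measure_not_isSmallNoise_le hx.2.2.1 hκ hCx hx.1.1 hfam hs hN hsize
    hT hτ).trans ?_
  gcongr

end Model

/-! ### Asymptotics -/

lemma mul_sqrt_le_of_le_div {H l z : ℝ} (hH : 0 < H) (h : H ≤ l / √z) : 0 < z ∧ H * √z ≤ l := by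
  rcases le_or_gt z 0 with hz | hz
  · rw [Real.sqrt_eq_zero_of_nonpos hz, div_zero] at h
    linarith
  · exact ⟨hz, (le_div_iff₀ (Real.sqrt_pos.2 hz)).1 h⟩

lemma WHP.of_forall_eventually {Ω : ℕ → Type*} [∀ t, MeasurableSpace (Ω t)]
    {P : ∀ t, Measure (Ω t)} {E : ∀ t, Set (Ω t)}
    (h : ∀ ε : ℝ, 0 < ε → ∀ᶠ t in atTop, P t (E t)ᶜ ≤ ENNReal.ofReal ε) : WHP P E := by
  refine ENNReal.tendsto_nhds_zero.2 fun ε hε => ?_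
  rcases eq_or_ne ε ⊤ with rfl | hne
  · exact Eventually.of_forall fun t => le_top
  · filter_upwards [h ε.toReal (ENNReal.toReal_pos hε.ne' hne)] with t ht
    rwa [ENNReal.ofReal_toReal hne] at ht

end FOL

theorem theorem1
    -- the exponential family
    (m : Measure ℝ) [SigmaFinite m] (c : ℝ → ℝ → ℝ) (d : ℝ → ℝ)
    -- the number of subgroups, and the sequence of models
    (G : ℕ) (hG : 2 ≤ G) (M : ℕ → FOL.Model G)
    (hgrp : ∀ t, Function.Surjective (M t).grp)
    (hfam : ∀ t k, FOL.IsExpFamily m c d ((M t).phi k))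
    -- diverging sample sizes of the same order
    (nstar : ℕ → ℝ) (hnstar : Tendsto nstar atTop atTop)
    (cn Cn : ℝ) (hcn : 0 < cn)
    (hn : ∀ t k, cn * nstar t ≤ (M t).n k ∧ ((M t).n k : ℝ) ≤ Cn * nstar t)
    -- the data
    (Ω : ℕ → Type*) [∀ t, MeasurableSpace (Ω t)] (P : ∀ t, Measure (Ω t))
    [∀ t, IsProbabilityMeasure (P t)]
    (X : ∀ t, Ω t → (M t).Design) (Y : ∀ t, Ω t → (M t).Resp)
    (hdata : ∀ t, (M t).IsData m c d (P t) (X t) (Y t))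
    -- the conditions on the design and the errors
    (Cx c1 C1 C2 κ C3 : ℝ) (hCx : 0 < Cx) (hc1 : 0 < c1) (hC1 : 0 < C1) (hC2 : 0 < C2)
    (hκ : 0 < κ) (hC3 : 0 < C3)
    (hreg : FOL.WHP P fun t => {ω | (M t).Regular m c d Cx c1 C1 C2 κ C3 (X t ω)})
    -- the penalty and the tuning parameters
    (ρ : ℝ → ℝ → ℝ) (a : ℝ) (ha : 0 < a) (hρ : FOL.IsPenalty ρ a)
    (lam1 lam2 : ℕ → ℝ)
    (hd1 : ∀ t, 2 * a * lam1 t < (M t).d1) (hd2 : ∀ t, 2 * a * lam2 t < (M t).d2)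
    (hlam1 : Tendsto (fun t => lam1 t /
      √((Real.log ((M t).p * (M t).K) + (M t).s) / (M t).Nbar)) atTop atTop)
    (hlam2 : Tendsto (fun t => lam2 t / √((M t).s / (M t).Nbar)) atTop atTop)
    -- the oracle estimators: minimizers, wherever there are any
    (Xihat : ∀ t, Ω t → Fin G → Fin (M t).p → ℝ)
    (hXihat : ∀ t ω, (∃ Ξ, (M t).IsOracleXi d (X t ω) (Y t ω) Ξ) →
      (M t).IsOracleXi d (X t ω) (Y t ω) (Xihat t ω))
    (Bor : ∀ t, Ω t → (M t).Coef)
    (hBor : ∀ t ω, (∃ B, (M t).IsOracleB d (X t ω) (Y t ω) B) →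
      (M t).IsOracleB d (X t ω) (Y t ω) (Bor t ω)) :
    -- the oracle estimators exist and are unique, with probability tending to one
    FOL.WHP P (fun t => {ω | ∃! Ξ, (M t).IsOracleXi d (X t ω) (Y t ω) Ξ}) ∧
    FOL.WHP P (fun t => {ω | ∃! B, (M t).IsOracleB d (X t ω) (Y t ω) B}) ∧
    -- their rate of convergence
    FOL.IsBigOp P (fun t ω => (M t).errXi (Xihat t ω)) (fun t => √((M t).s / (M t).Nbar)) ∧
    FOL.IsBigOp P (fun t ω => (M t).errB (Bor t ω)) (fun t => √((M t).s / (M t).Nbar)) ∧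
    -- the penalized estimator
    ∃ Bhat : ∀ t, Ω t → (M t).Coef,
      (∀ t ω,
        (∃ B, FOL.IsStrictLocalMin ((M t).Q d ρ (lam1 t) (lam2 t) (X t ω) (Y t ω)) B) →
        FOL.IsStrictLocalMin ((M t).Q d ρ (lam1 t) (lam2 t) (X t ω) (Y t ω)) (Bhat t ω)) ∧
      FOL.WHP P (fun t => {ω | FOL.IsStrictLocalMin
        ((M t).Q d ρ (lam1 t) (lam2 t) (X t ω) (Y t ω)) (Bhat t ω)}) ∧
      FOL.WHP P (fun t => {ω | Bhat t ω = Bor t ω}) ∧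
      -- consistent variable selection and subgroup recovery
      FOL.WHP P (fun t => {ω | ∀ k, FOL.supp (Bhat t ω k) = FOL.supp ((M t).beta k)}) ∧
      FOL.WHP P (fun t => {ω | Setoid.ker (Bhat t ω) = Setoid.ker (M t).grp}) := by
  classical
  have hG0 : 0 < G := by omega
  set r : ℕ → ℝ := fun t => √((M t).s / (M t).Nbar) with hr
  have hr0 : ∀ t, 0 ≤ r t := fun t => Real.sqrt_nonneg _
  set Good : ℝ → ∀ t, Set (Ω t) := fun D t =>
    {ω | ∃ Ξ, (M t).IsGood d (X t ω) (Y t ω) ρ (lam1 t) (lam2 t) (D * r t) Ξ} with hGood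
  have hev : ∀ H : ℝ, 0 < H → ∀ᶠ t in atTop,
      H * √((Real.log ((M t).p * (M t).K) + (M t).s) / (M t).Nbar) ≤ lam1 t ∧
      H * √((M t).s / (M t).Nbar) ≤ lam2 t ∧ 0 < (M t).s ∧ 0 < (M t).Nbar := by
    intro H hH
    filter_upwards [hlam1.eventually_ge_atTop H, hlam2.eventually_ge_atTop H] with t h1 h2
    obtain ⟨h3, h4⟩ := FOL.mul_sqrt_le_of_le_div hH h2
    refine ⟨(FOL.mul_sqrt_le_of_le_div hH h1).2, h4, ?_, ?_⟩
    · refine Nat.pos_of_ne_zero fun h0 => ?_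
      simp [h0] at h3
    · refine Nat.pos_of_ne_zero fun h0 => ?_
      simp [h0] at h3
  have hN : ∀ᶠ t in atTop, 0 < (M t).N := by
    filter_upwards [hev 1 one_pos] with t ht
    exact ht.2.2.2.trans_le
      ((FOL.Model.Nbar_le_size ⟨0, hG0⟩).trans (FOL.Model.size_le_N _))
  -- good outcomes have probability close to one, at a radius that depends on the tolerance
  have hmain : ∀ ε : ℝ, 0 < ε → ∃ D : ℝ, 0 < D ∧
      ∀ᶠ t in atTop, P t (Good D t)ᶜ ≤ ENNReal.ofReal ε := by
    intro ε hε
    set T : ℝ := 5 * (G + 1) * (6 / κ * Cx ^ 2) / ε with hT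
    have hT0 : 0 < T := by positivity
    set Λ : ℝ := 1 + 10 / ε with hΛ
    have hΛ1 : 1 ≤ Λ := by
      have : 0 < 10 / ε := by positivity
      linarith
    set D : ℝ := 3 * √T / c1 with hD
    have hsT : 0 < √T := Real.sqrt_pos.2 hT0
    have hD0 : 0 < D := by positivity
    refine ⟨D, hD0, ?_⟩
    set H : ℝ := 1 + 2 * (D / a) + 8 * (Cx * (16 / κ * √Cx * D)) + 16 * √T +
      16 * (16 / κ * Cx * D) + 64 * Cx ^ 2 * Λ / κ with hH
    have hH0 : 0 < H := by positivity
    have hreg' := ENNReal.tendsto_nhds_zero.1 hreg (ENNReal.ofReal (ε / 5))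
      (ENNReal.ofReal_pos.2 (by positivity))
    filter_upwards [hev H hH0, hreg'] with t ht hregt
    have h1 := (hdata t).measure_not_isGood_le (C1 := C1) (C2 := C2) (C3 := C3) (hfam t) (hgrp t)
      hG0 hCx hc1 hκ ha hρ (hd1 t) (hd2 t) ht.2.2.1 ht.2.2.2 hT0 hΛ1 hD hH.ge ht.1 ht.2.1
    have b1 : G * (6 / κ * Cx ^ 2 / T) ≤ ε / 5 := by
      have : (G : ℝ) * (6 / κ * Cx ^ 2 / T) = G / (G + 1) * (ε / 5) := by
        rw [hT]; field_simp
      rw [this]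
      exact mul_le_of_le_one_left (by positivity)
        ((div_le_one (by positivity)).2 (by linarith))
    have b2 : 6 / κ * Cx ^ 2 / T ≤ ε / 5 := by
      have : 6 / κ * Cx ^ 2 / T = 1 / ((G : ℝ) + 1) * (ε / 5) := by
        rw [hT]; field_simp
      rw [this]
      exact mul_le_of_le_one_left (by positivity)
        ((div_le_one (by positivity)).2 (by linarith [(Nat.cast_nonneg G : (0 : ℝ) ≤ G)]))
    have b3 : 2 * Real.exp (-Λ) ≤ ε / 5 := by
      have h2 : 10 / ε ≤ Real.exp Λ := by
        have := Real.add_one_le_exp Λ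
        linarith
      rw [Real.exp_neg, ← div_eq_mul_inv, div_le_iff₀ (Real.exp_pos _)]
      rw [div_le_iff₀ hε] at h2
      linarith
    calc _ ≤ _ := h1
      _ ≤ ENNReal.ofReal (ε / 5) + ENNReal.ofReal (ε / 5) + ENNReal.ofReal (ε / 5) +
          ENNReal.ofReal (ε / 5) + ENNReal.ofReal (ε / 5) := by gcongr
      _ = ENNReal.ofReal ε := by
          rw [← ENNReal.ofReal_add, ← ENNReal.ofReal_add, ← ENNReal.ofReal_add,
            ← ENNReal.ofReal_add]
          · congr 1
            ring
          all_goals positivity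
  have hwhp : ∀ E : ∀ t, Set (Ω t), (∀ D t, 0 < (M t).N → Good D t ⊆ E t) → FOL.WHP P E := by
    intro E hE
    refine FOL.WHP.of_forall_eventually fun ε hε => ?_
    obtain ⟨D, -, hD⟩ := hmain ε hε
    filter_upwards [hD, hN] with t ht hNt
    exact (measure_mono (Set.compl_subset_compl.2 (hE D t hNt))).trans ht
  have hbig : ∀ Z : ∀ t, Ω t → ℝ,
      (∀ D t, 0 < D → 0 < (M t).N → ∀ ω ∈ Good D t, |Z t ω| ≤ D * r t) →
      FOL.IsBigOp P Z r := by
    intro Z hZ ε hε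
    obtain ⟨D, hD0, hD⟩ := hmain ε hε
    refine ⟨D, hD0, ?_⟩
    filter_upwards [hD, hN] with t ht hNt
    refine (measure_mono fun ω hω hg => ?_).trans ht
    exact absurd (hZ D t hD0 hNt ω hg) (not_le.2 hω)
  have hXi : ∀ t, 0 < (M t).N → ∀ ω Ξ,
      (M t).IsGroupwiseMin d (X t ω) (Y t ω) Ξ → Xihat t ω = Ξ := fun t hNt ω Ξ h =>
    (h.isOracleXi_iff hNt).1 (hXihat t ω ⟨Ξ, (h.isOracleXi_iff hNt).2 rfl⟩)
  have hB : ∀ t, 0 < (M t).N → ∀ ω Ξ, (M t).IsGroupwiseMin d (X t ω) (Y t ω) Ξ →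
      Bor t ω = fun k => Ξ ((M t).grp k) := fun t hNt ω Ξ h =>
    (h.isOracleB_iff hNt (hgrp t)).1 (hBor t ω ⟨_, (h.isOracleB_iff hNt (hgrp t)).2 rfl⟩)
  -- the oracle estimator is chosen wherever it is a strict local minimizer
  set Bhat : ∀ t, Ω t → (M t).Coef := fun t ω =>
    if FOL.IsStrictLocalMin ((M t).Q d ρ (lam1 t) (lam2 t) (X t ω) (Y t ω)) (Bor t ω) then
      Bor t ω
    else if h : ∃ B, FOL.IsStrictLocalMin
        ((M t).Q d ρ (lam1 t) (lam2 t) (X t ω) (Y t ω)) B then h.choose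
    else 0 with hBhat
  have hBh : ∀ D t, 0 < (M t).N → ∀ ω ∈ Good D t, ∃ Ξ,
      (M t).IsGood d (X t ω) (Y t ω) ρ (lam1 t) (lam2 t) (D * r t) Ξ ∧
      Bor t ω = (fun k => Ξ ((M t).grp k)) ∧ Bhat t ω = fun k => Ξ ((M t).grp k) := by
    rintro D t hNt ω ⟨Ξ, h⟩
    have h1 := hB t hNt ω Ξ h.groupwiseMin
    refine ⟨Ξ, h, h1, ?_⟩
    have h2 := h.isStrictLocalMin
    rw [← h1] at h2 ⊢
    exact if_pos h2
  refine ⟨?_, ?_, ?_, ?_, Bhat, ?_, ?_, ?_, ?_, ?_⟩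
  · refine hwhp _ fun D t hNt => ?_
    rintro ω ⟨Ξ, h⟩
    exact ⟨Ξ, (h.groupwiseMin.isOracleXi_iff hNt).2 rfl,
      fun Ξ' h' => (h.groupwiseMin.isOracleXi_iff hNt).1 h'⟩
  · refine hwhp _ fun D t hNt => ?_
    rintro ω ⟨Ξ, h⟩
    exact ⟨_, (h.groupwiseMin.isOracleB_iff hNt (hgrp t)).2 rfl,
      fun B h' => (h.groupwiseMin.isOracleB_iff hNt (hgrp t)).1 h'⟩
  · refine hbig _ fun D t hD hNt => ?_
    rintro ω ⟨Ξ, h⟩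
    rw [hXi t hNt ω Ξ h.groupwiseMin]
    exact h.abs_errXi_le (mul_nonneg hD.le (hr0 t))
  · refine hbig _ fun D t hD hNt => ?_
    rintro ω ⟨Ξ, h⟩
    rw [hB t hNt ω Ξ h.groupwiseMin]
    exact h.abs_errB_le (mul_nonneg hD.le (hr0 t))
  · intro t ω hex
    simp only [hBhat]
    split_ifs with h1
    · exact h1
    · exact hex.choose_spec
  · refine hwhp _ fun D t hNt ω hω => ?_
    obtain ⟨Ξ, h, -, h2⟩ := hBh D t hNt ω hω
    change FOL.IsStrictLocalMin _ (Bhat t ω)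
    rw [h2]
    exact h.isStrictLocalMin
  · refine hwhp _ fun D t hNt ω hω => ?_
    obtain ⟨Ξ, -, h1, h2⟩ := hBh D t hNt ω hω
    exact h2.trans h1.symm
  · refine hwhp _ fun D t hNt ω hω k => ?_
    obtain ⟨Ξ, h, -, h2⟩ := hBh D t hNt ω hω
    rw [h2]
    exact h.supp_eq k
  · refine hwhp _ fun D t hNt ω hω => ?_
    obtain ⟨Ξ, h, -, h2⟩ := hBh D t hNt ω hω
    change Setoid.ker (Bhat t ω) = _
    rw [h2]
    exact h.ker_eq
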